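/- All graphs are finite, simple and undirected. A path on the grid is a simple path with at least one edge in the square grid graph on $\mathbb{Z}^2$; a bend of it is a grid-point at which it makes a $90^\circ$ turn. Two such paths are interiorly disjoint if the curves they trace in the plane have no common point that is an interior point (a point other than an endpoint) of both; they touch if they have a common grid-point. A CPG representation of a graph $G=(V,E)$ is a family $(P_v)_{v\in V}$ of pairwise interiorly disjoint paths on the grid such that distinct vertices $u,v$ are adjacent if and only if $P_u$ and $P_v$ touch. A graph is CPG if it has a CPG representation, and $B_k$-CPG if it has one in which every path has at most $k$ bends. The bend number (with respect to CPG representations) of a class of graphs is the least $k \ge 0$ such that every graph in the class is $B_k$-CPG, and it is unbounded ($=\infty$) if no such $k$ exists. (1) For every $k \ge 0$ there is a planar graph $G_k$ that is $B_{k+1}$-CPG but not $B_k$-CPG; moreover, every CPG representation of $G_k$ contains a path with at least $k+1$ bends. (2) For every $k \ge 0$, the class of $B_k$-CPG graphs is strictly contained in the class of $B_{k+1}$-CPG graphs, and the class of planar $B_k$-CPG graphs is strictly contained in the class of planar $B_{k+1}$-CPG graphs. (3) The class of planar CPG graphs has unbounded bend number with respect to CPG representations. -/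

import Mathlib

namespace CPG

/-- The (infinite) square grid: vertices are the integer points, and two points are joined by a
grid-edge iff they are at distance one, horizontally or vertically. -/
def grid : SimpleGraph (ℤ × ℤ) where
  Adj p q :=
    (p.2 = q.2 ∧ (q.1 = p.1 + 1 ∨ p.1 = q.1 + 1)) ∨
      (p.1 = q.1 ∧ (q.2 = p.2 + 1 ∨ p.2 = q.2 + 1))
  symm := ⟨fun p q h => by
    rcases h with ⟨h, h'⟩ | ⟨h, h'⟩
    · exact Or.inl ⟨h.symm, h'.symm⟩
    · exact Or.inr ⟨h.symm, h'.symm⟩⟩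
  loopless := ⟨fun p h => by
    rcases h with ⟨_, h | h⟩ | ⟨_, h | h⟩ <;> omega⟩

/-- A (simple) path on the grid. It has two distinct endpoints, that is, at least one
grid-edge. -/
structure GridPath where
  start : ℤ × ℤ
  finish : ℤ × ℤ
  walk : grid.Walk start finish
  isPath : walk.IsPath
  start_ne_finish : start ≠ finish

namespace GridPath

/-- The grid-points of a path. -/
def points (P : GridPath) : Set (ℤ × ℤ) := {p | p ∈ P.walk.support}

/-- The grid-points of a path other than its two endpoints. -/
def interiorPoints (P : GridPath) : Set (ℤ × ℤ) :=
  {p | p ∈ P.walk.support ∧ p ≠ P.start ∧ p ≠ P.finish}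

/-- The grid-edges of a path. -/
def edges (P : GridPath) : Set (Sym2 (ℤ × ℤ)) := {e | e ∈ P.walk.edges}

/-- The number of bends: the interior positions of the path at which the step into the point and
the step out of it have different directions. As the path never turns back, these are exactly the
points at which it makes a turn of 90 degrees. -/
def bends (P : GridPath) : ℕ :=
  ((Finset.Ioo 0 P.walk.length).filter fun i =>
    P.walk.getVert (i + 1) - P.walk.getVert i ≠ P.walk.getVert i - P.walk.getVert (i - 1)).card

/-- Two paths are interiorly disjoint if no point of the plane is an interior point of both of the
curves that they trace (an endpoint of one may be an interior point of the other). The interior of such a curve consists of the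
interior grid-points and of the relative interiors of the grid-edges, so this says that no
grid-point is interior to both paths and that they share no grid-edge. -/
def InteriorlyDisjoint (P Q : GridPath) : Prop :=
  Disjoint P.interiorPoints Q.interiorPoints ∧ Disjoint P.edges Q.edges

/-- Two paths touch if they have a common grid-point. -/
def Touch (P Q : GridPath) : Prop := (P.points ∩ Q.points).Nonempty

end GridPath

/-- A CPG representation of `G`: pairwise interiorly disjoint paths on the grid, one for each
vertex, such that two distinct vertices are adjacent iff their paths touch. -/
structure Representation {V : Type*} (G : SimpleGraph V) where
  path : V → GridPath
  interiorlyDisjoint : ∀ u v : V, u ≠ v → (path u).InteriorlyDisjoint (path v)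
  adj_iff : ∀ u v : V, u ≠ v → (G.Adj u v ↔ (path u).Touch (path v))

/-- `G` is a CPG graph. -/
def IsCPG {V : Type*} (G : SimpleGraph V) : Prop := Nonempty (Representation G)

/-- `G` is a `B_k`-CPG graph: it has a CPG representation all of whose paths have at most `k`
bends. -/
def IsBendCPG (k : ℕ) {V : Type*} (G : SimpleGraph V) : Prop :=
  ∃ R : Representation G, ∀ v : V, (R.path v).bends ≤ k

/-- An embedding of `G` in the plane without crossings: vertices are distinct points, an edge is
an arc (the image of an injective continuous map on the unit interval) between the points of its
two ends, and the interior of such an arc contains no vertex and no point of another edge. -/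
structure PlaneEmbedding {V : Type*} (G : SimpleGraph V) where
  pos : V → ℝ × ℝ
  pos_injective : Function.Injective pos
  arc : G.edgeSet → unitInterval → ℝ × ℝ
  arc_continuous : ∀ e, Continuous (arc e)
  arc_injective : ∀ e, Function.Injective (arc e)
  arc_ends : ∀ e, s(arc e 0, arc e 1) = Sym2.map pos (e : Sym2 V)
  arc_ne_pos : ∀ (e : G.edgeSet) (t : unitInterval), t ≠ 0 → t ≠ 1 → ∀ v : V, arc e t ≠ pos v
  arc_ne_arc : ∀ e f : G.edgeSet, e ≠ f →
    ∀ t : unitInterval, t ≠ 0 → t ≠ 1 → ∀ s : unitInterval, arc e t ≠ arc f s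

/-- `G` is planar. -/
def IsPlanar {V : Type*} (G : SimpleGraph V) : Prop := Nonempty (PlaneEmbedding G)

/-- Finite simple graphs; up to isomorphism their vertex set is `{0, …, n - 1}` for some `n`. -/
abbrev FiniteGraph : Type := Σ n : ℕ, SimpleGraph (Fin n)

/-- The class of planar graphs. -/
def planarGraphs : Set FiniteGraph := {G | IsPlanar G.2}

/-- The class of CPG graphs. -/
def cpgGraphs : Set FiniteGraph := {G | IsCPG G.2}

/-- The class of `B_k`-CPG graphs. -/
def bendCPGGraphs (k : ℕ) : Set FiniteGraph := {G | IsBendCPG k G.2}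

/-- The bend number with respect to CPG representations of a class of graphs: the least `k` such
that every graph in the class is `B_k`-CPG, and `⊤` if there is no such `k`. -/
noncomputable def bendNumber (C : Set FiniteGraph) : ℕ∞ :=
  sInf {m : ℕ∞ | ∃ k : ℕ, m = (k : ℕ∞) ∧ C ⊆ bendCPGGraphs k}

end CPG

/-! A necklace with `k + 3` beads forces `k + 1` bends on the path `A` of the pole `false`. In a
bead, five rim paths touch in a cycle, and all of them touch both `A` and the hub path `B`. Every
contact uses up an endpoint of one of the two paths. If no endpoint of `A` lies on the rim, each rim
path spends one endpoint on `A`. If the cyclic contacts all lay off `A`, they would consume the five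
remaining endpoints, and the contacts with `B` would have to be at the two endpoints of `B`. Two
non-consecutive rim paths would then meet. So two consecutive rim paths end at a common interior
point `p` of `A` (`GridPath.exists_common_point`).

If `A` goes straight through `p`, these two rim paths leave `p` on opposite sides of `A` and are
joined through `B`. The resulting closed curve meets `A` only at `p` and crosses it there, so it
separates the parts of `A` before and after `p` (`GridPath.exists_separating_coloring`). The other
beads are linked through the pole `true` without touching this curve, hence all of them meet `A` on
the same side of `p`. Thus a bead without a bend of `A` on its rim comes first or last along `A`,
and at most two beads can do so (`necklace_le_bends`).

Conversely, a staircase with beads at its two ends and at its corners attains the bound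
(`isBendCPG_necklace`). The paths inside a bead need two bends there, so `k = 0` is settled
separately by a book of nine triangles: straight paths have the Helly property, which would crowd
five paths into one grid-point (`not_isBendCPG_zero_book`). Both graphs are planar by explicit
straight-line drawings. -/

namespace CPG

open SimpleGraph

/-! ### Parity colourings of the faces of the grid -/

/-- The indicator of the horizontal ray of `p` to the right. -/
def rayIndicator (p : ℤ × ℤ) (x y : ℤ) : ZMod 2 := if p.2 = y ∧ p.1 ≤ x then 1 else 0

/-- `F x y` is the colour of the unit square with lower left corner `(x, y)`. Closed up by the
rightward rays of its two ends, a walk has even degree everywhere, so its faces can be two-coloured.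
Inductively, a horizontal step only lengthens or shortens a ray, while a vertical step flips the
squares to its right in one row. -/
theorem exists_faceColoring_of_walk {p q : ℤ × ℤ} (w : grid.Walk p q) :
    ∃ F : ℤ → ℤ → ZMod 2,
      (∀ x y, F x y = F (x - 1) y + (w.edges.count s((x, y), (x, y + 1)) : ℕ)) ∧
      (∀ x y, F x y = F x (y - 1) + (w.edges.count s((x, y), (x + 1, y)) : ℕ) +
        rayIndicator p x y + rayIndicator q x y) := by
  induction w with
  | @nil u =>
    refine ⟨fun _ _ => 0, fun x y => by simp, fun x y => ?_⟩
    rw [add_assoc, CharTwo.add_self_eq_zero]; simp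
  | @cons u v z h w ih =>
    obtain ⟨F, h1, h2⟩ := ih
    obtain ⟨a, b⟩ := u
    obtain ⟨c, d⟩ := v
    have h0 : (b = d ∧ (c = a + 1 ∨ a = c + 1)) ∨ (a = c ∧ (d = b + 1 ∨ b = d + 1)) := h
    rcases h0 with ⟨rfl, rfl | rfl⟩ | ⟨rfl, rfl | rfl⟩
    · refine ⟨F, fun x y => ?_, fun x y => ?_⟩
      · rw [h1 x y, Walk.edges_cons, List.count_cons_of_ne]
        simp only [ne_eq, Sym2.eq_iff, Prod.mk.injEq]; omega
      · rw [h2 x y, Walk.edges_cons, List.count_cons]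
        simp only [beq_iff_eq, Sym2.eq_iff, Prod.mk.injEq, rayIndicator]
        push_cast
        split_ifs <;> first | omega | grind
    · refine ⟨F, fun x y => ?_, fun x y => ?_⟩
      · rw [h1 x y, Walk.edges_cons, List.count_cons_of_ne]
        simp only [ne_eq, Sym2.eq_iff, Prod.mk.injEq]; omega
      · rw [h2 x y, Walk.edges_cons, List.count_cons]
        simp only [beq_iff_eq, Sym2.eq_iff, Prod.mk.injEq, rayIndicator]
        push_cast
        split_ifs <;> first | omega | grind
    · refine ⟨fun x y => F x y + rayIndicator (a, b) x y, fun x y => ?_, fun x y => ?_⟩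
      · beta_reduce
        rw [h1 x y, Walk.edges_cons, List.count_cons]
        simp only [beq_iff_eq, Sym2.eq_iff, Prod.mk.injEq, rayIndicator]
        push_cast
        split_ifs <;> first | omega | grind
      · beta_reduce
        rw [h2 x y, Walk.edges_cons, List.count_cons_of_ne]
        · simp only [rayIndicator]
          split_ifs <;> first | omega | grind
        · simp only [ne_eq, Sym2.eq_iff, Prod.mk.injEq]; omega
    · refine ⟨fun x y => F x y + rayIndicator (a, d) x y, fun x y => ?_, fun x y => ?_⟩
      · beta_reduce
        rw [h1 x y, Walk.edges_cons, List.count_cons]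
        simp only [beq_iff_eq, Sym2.eq_iff, Prod.mk.injEq, rayIndicator]
        push_cast
        split_ifs <;> first | omega | grind
      · beta_reduce
        rw [h2 x y, Walk.edges_cons, List.count_cons_of_ne]
        · simp only [rayIndicator]
          split_ifs <;> first | omega | grind
        · simp only [ne_eq, Sym2.eq_iff, Prod.mk.injEq]; omega

theorem count_edges_eq_zero {p q u v : ℤ × ℤ} (w : grid.Walk p q)
    (hu : u ∉ w.support ∨ v ∉ w.support) : w.edges.count s(u, v) = 0 := by
  refine List.count_eq_zero_of_not_mem fun h => ?_
  rcases hu with hu | hu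
  · exact hu (w.fst_mem_support_of_mem_edges h)
  · exact hu (w.snd_mem_support_of_mem_edges h)

/-- A closed walk on the grid two-colours the grid-points off the walk: the colour does not change
along a grid-edge that avoids the walk, and it changes across a point at which the walk is crossed
straight. -/
theorem exists_pointColoring {z : ℤ × ℤ} (w : grid.Walk z z) :
    ∃ c : ℤ × ℤ → ZMod 2,
      (∀ p q, grid.Adj p q → p ∉ w.support → q ∉ w.support → c p = c q) ∧
      (∀ p u v e, grid.Adj p u → grid.Adj p e → v - p = p - u → e ≠ u → e ≠ v →
        u ∉ w.support → v ∉ w.support → w.edges.count s(p, e) = 1 → c u ≠ c v) := by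
  obtain ⟨F, h1, h2⟩ := exists_faceColoring_of_walk w
  -- For a closed walk the two rays coincide and cancel modulo 2.
  replace h2 : ∀ x y, F x y = F x (y - 1) + (w.edges.count s((x, y), (x + 1, y)) : ℕ) := by
    intro x y
    rw [h2 x y, add_assoc _ (rayIndicator z x y), CharTwo.add_self_eq_zero, add_zero]
  -- None of the four grid-edges at a point off the walk is used, so the four squares around it have
  -- one colour.
  have hW : ∀ x y, (x, y) ∉ w.support → F x y = F (x - 1) y := fun x y h => by
    rw [h1 x y, count_edges_eq_zero w (Or.inl h)]; simp
  have hS : ∀ x y, (x, y) ∉ w.support → F x y = F x (y - 1) := fun x y h => by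
    rw [h2 x y, count_edges_eq_zero w (Or.inl h)]; simp
  have hW' : ∀ x y, (x, y) ∉ w.support → F x (y - 1) = F (x - 1) (y - 1) := fun x y h => by
    rw [h1 x (y - 1), count_edges_eq_zero w (Or.inr (by simpa using h))]; simp
  have hS' : ∀ x y, (x, y) ∉ w.support → F (x - 1) y = F (x - 1) (y - 1) := fun x y h => by
    rw [h2 (x - 1) y, count_edges_eq_zero w (Or.inr (by simpa using h))]; simp
  have one : ∀ a b : ZMod 2, a = b + 1 → a ≠ b := by decide
  -- A point takes the colour of the square to its upper right; off the walk, any of its four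
  -- squares would do.
  refine ⟨fun p => F p.1 p.2, ?_, ?_⟩
  · have key : ∀ p q : ℤ × ℤ, (p.2 = q.2 ∧ q.1 = p.1 + 1) ∨ (p.1 = q.1 ∧ q.2 = p.2 + 1) →
        q ∉ w.support → F p.1 p.2 = F q.1 q.2 := by
      rintro ⟨a, b⟩ ⟨c, d⟩ (⟨h, h'⟩ | ⟨h, h'⟩) hq <;> simp only at h h' <;> subst h <;> subst h'
      · simpa using (hW _ _ hq).symm
      · simpa using (hS _ _ hq).symm
    rintro p q (⟨h, h' | h'⟩ | ⟨h, h' | h'⟩) hp hq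
    · exact key p q (Or.inl ⟨h, h'⟩) hq
    · exact (key q p (Or.inl ⟨h.symm, h'⟩) hp).symm
    · exact key p q (Or.inr ⟨h, h'⟩) hq
    · exact (key q p (Or.inr ⟨h.symm, h'⟩) hp).symm
  · -- by symmetry, `u` is to the left of `p` or below `p`
    have key : ∀ p u v e : ℤ × ℤ, (p = (u.1 + 1, u.2) ∨ p = (u.1, u.2 + 1)) → grid.Adj p e →
        v - p = p - u → e ≠ u → e ≠ v → u ∉ w.support → v ∉ w.support →
        w.edges.count s(p, e) = 1 → F u.1 u.2 ≠ F v.1 v.2 := by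
      -- The edge from `p` to `e` is perpendicular to the line through `u`, `p`, `v`. Of the two
      -- squares along it, one has `u` as a corner and the other has `v`, and the single traversal
      -- gives them different colours.
      rintro p ⟨a, b⟩ ⟨c, d⟩ ⟨e, f⟩ hp he hv heu hev hu hv' hc
      rcases hp with rfl | rfl
      · obtain ⟨rfl, rfl⟩ : c = a + 2 ∧ d = b := by
          simp only [Prod.mk_sub_mk, Prod.mk.injEq] at hv; omega
        have hv1 := hW _ _ hv'
        have hv2 := hS' _ _ hv'
        have hu1 := hS _ _ hu
        rw [show a + 2 - 1 = a + 1 by ring] at hv1 hv2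
        rcases he with ⟨h, h' | h'⟩ | ⟨h, h' | h'⟩ <;> simp only [ne_eq, Prod.mk.injEq] at h h' heu hev
        · omega
        · omega
        · subst h h'
          have := h1 (a + 1) d
          rw [hc, show a + 1 - 1 = a by ring] at this
          simp only [hv1]
          exact (one _ _ (by simpa using this)).symm
        · subst h
          obtain rfl : f = d - 1 := by omega
          have := h1 (a + 1) (d - 1)
          rw [show d - 1 + 1 = d by ring, Sym2.eq_swap] at this
          simp only at hc
          rw [hc, show a + 1 - 1 = a by ring] at this
          simp only [hv1, hv2, hu1]
          exact (one _ _ (by simpa using this)).symm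
      · obtain ⟨rfl, rfl⟩ : c = a ∧ d = b + 2 := by
          simp only [Prod.mk_sub_mk, Prod.mk.injEq] at hv; omega
        have hv1 := hS _ _ hv'
        have hv2 := hW' _ _ hv'
        have hu1 := hW _ _ hu
        rw [show b + 2 - 1 = b + 1 by ring] at hv1 hv2
        rcases he with ⟨h, h' | h'⟩ | ⟨h, h' | h'⟩ <;> simp only [ne_eq, Prod.mk.injEq] at h h' heu hev
        · subst h h'
          have := h2 c (b + 1)
          rw [hc, show b + 1 - 1 = b by ring] at this
          simp only [hv1]
          exact (one _ _ (by simpa using this)).symm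
        · subst h
          obtain rfl : e = c - 1 := by omega
          have := h2 (c - 1) (b + 1)
          rw [show c - 1 + 1 = c by ring, Sym2.eq_swap] at this
          rw [hc, show b + 1 - 1 = b by ring] at this
          simp only [hv1, hv2, hu1]
          exact (one _ _ (by simpa using this)).symm
        · omega
        · omega
    intro p u v e hpu hpe hv heu hev hu hv' hc
    have hv0 := hv
    simp only [Prod.ext_iff, Prod.fst_sub, Prod.snd_sub] at hv
    by_cases h : p = (u.1 + 1, u.2) ∨ p = (u.1, u.2 + 1)
    · exact key p u v e h hpe hv0 heu hev hu hv' hc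
    · refine (key p v u e ?_ hpe (by rw [← neg_sub, ← hv0, neg_sub]) hev heu hv' hu hc).symm
      simp only [Prod.ext_iff] at h ⊢
      rcases hpu with ⟨h, h' | h'⟩ | ⟨h, h' | h'⟩ <;> omega


/-! ### Contacts between paths: separation and endpoint counting -/

namespace GridPath

theorem start_mem (P : GridPath) : P.start ∈ P.points := P.walk.start_mem_support

theorem InteriorlyDisjoint.symm {P Q : GridPath} (h : P.InteriorlyDisjoint Q) :
    Q.InteriorlyDisjoint P := ⟨h.1.symm, h.2.symm⟩

/-- `z` is an endpoint of `P`. -/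
def IsEnd (P : GridPath) (z : ℤ × ℤ) : Prop := z = P.start ∨ z = P.finish

theorem InteriorlyDisjoint.isEnd {P Q : GridPath} (h : P.InteriorlyDisjoint Q) {z : ℤ × ℤ}
    (hP : z ∈ P.points) (hQ : z ∈ Q.points) : P.IsEnd z ∨ Q.IsEnd z := by
  by_contra! hn
  simp only [IsEnd, not_or] at hn
  exact Set.disjoint_left.1 h.1 (⟨hP, hn.1⟩ : z ∈ P.interiorPoints) ⟨hQ, hn.2⟩

theorem exists_walk (P : GridPath) {z z' : ℤ × ℤ} (hz : z ∈ P.points) (hz' : z' ∈ P.points) :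
    ∃ w : grid.Walk z z', w.support ⊆ P.walk.support ∧ w.edges ⊆ P.walk.edges := by
  refine ⟨(P.walk.takeUntil z hz).reverse.append (P.walk.takeUntil z' hz'), fun x hx => ?_,
    fun e he => ?_⟩
  · rw [Walk.mem_support_append_iff, Walk.support_reverse, List.mem_reverse] at hx
    exact hx.elim (fun h => P.walk.support_takeUntil_subset_support hz h)
      (fun h => P.walk.support_takeUntil_subset_support hz' h)
  · rw [Walk.edges_append, List.mem_append, Walk.edges_reverse, List.mem_reverse] at he
    exact he.elim (fun h => P.walk.edges_takeUntil_subset_edges hz h)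
      (fun h => P.walk.edges_takeUntil_subset_edges hz' h)

/-- From an endpoint of a path one can walk along it to any of its points, without visiting the
other endpoint on the way. -/
theorem exists_path_of_isEnd (P : GridPath) {z z' : ℤ × ℤ} (hz : P.IsEnd z) (hz' : z' ∈ P.points) :
    ∃ w : grid.Walk z z', w.IsPath ∧ w.support ⊆ P.walk.support ∧ w.edges ⊆ P.walk.edges ∧
      ∀ x, P.IsEnd x → x ≠ z → x ≠ z' → x ∉ w.support := by
  rcases hz with rfl | rfl
  · refine ⟨P.walk.takeUntil z' hz', P.isPath.takeUntil hz',
      P.walk.support_takeUntil_subset_support hz', P.walk.edges_takeUntil_subset_edges hz', ?_⟩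
    rintro x (rfl | rfl) h h'
    · exact absurd rfl h
    · exact Walk.endpoint_notMem_support_takeUntil P.isPath hz' h'
  · have hz'' : z' ∈ P.walk.reverse.support := by
      rw [Walk.support_reverse, List.mem_reverse]; exact hz'
    refine ⟨P.walk.reverse.takeUntil z' hz'', P.isPath.reverse.takeUntil hz'', fun x hx => ?_,
      fun e he => ?_, ?_⟩
    · simpa using P.walk.reverse.support_takeUntil_subset_support hz'' hx
    · simpa using P.walk.reverse.edges_takeUntil_subset_edges hz'' he
    · rintro x (rfl | rfl) h h'
      · exact Walk.endpoint_notMem_support_takeUntil P.isPath.reverse hz'' h'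
      · exact absurd rfl h

theorem getVert_mem (P : GridPath) (i : ℕ) : P.walk.getVert i ∈ P.points :=
  P.walk.getVert_mem_support i

theorem edge_mem (P : GridPath) {i : ℕ} (hi : i < P.walk.length) :
    s(P.walk.getVert i, P.walk.getVert (i + 1)) ∈ P.edges := by
  have := P.walk.toSubgraph_adj_getVert hi
  rwa [← Subgraph.mem_edgeSet, Walk.mem_edges_toSubgraph] at this

theorem getVert_inj (P : GridPath) {i j : ℕ} (hi : i ≤ P.walk.length) (hj : j ≤ P.walk.length)
    (h : P.walk.getVert i = P.walk.getVert j) : i = j :=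
  P.isPath.getVert_injOn hi hj h

theorem color_eq_of_disjoint {c : ℤ × ℤ → ZMod 2} {S : Set (ℤ × ℤ)}
    (hc : ∀ p q, grid.Adj p q → p ∉ S → q ∉ S → c p = c q) (P : GridPath) {i j : ℕ} (hij : i ≤ j)
    (hj : j ≤ P.walk.length) (h : ∀ k, i ≤ k → k ≤ j → P.walk.getVert k ∉ S) :
    c (P.walk.getVert i) = c (P.walk.getVert j) := by
  induction j, hij using Nat.le_induction with
  | base => rfl
  | succ j hij ih =>
    rw [ih (by omega) fun k hk hk' => h k hk (by omega)]
    exact hc _ _ (P.walk.adj_getVert_succ (by omega)) (h j hij (by omega))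
      (h (j + 1) (by omega) le_rfl)

/-- If the paths `X` and `Y` end at a common point `p` in the interior of `A`, at which `A` does
not bend, and both touch a further path `B` that avoids `A`, then these three paths separate the
two sides of `A` at `p`. -/
theorem exists_separating_coloring {A B X Y : GridPath} (hAX : A.InteriorlyDisjoint X)
    (hAY : A.InteriorlyDisjoint Y) (hXY : X.InteriorlyDisjoint Y)
    (hBX : B.InteriorlyDisjoint X) (hAB : Disjoint A.points B.points) (hX : X.Touch B)
    (hY : Y.Touch B) (hXA : ∀ z, A.IsEnd z → z ∉ X.points) (hYA : ∀ z, A.IsEnd z → z ∉ Y.points)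
    {n : ℕ} (hn : n ≤ A.walk.length) (hnX : A.walk.getVert n ∈ X.points)
    (hnY : A.walk.getVert n ∈ Y.points)
    (hs : A.walk.getVert (n + 1) - A.walk.getVert n = A.walk.getVert n - A.walk.getVert (n - 1)) :
    ∃ c : ℤ × ℤ → ZMod 2,
      (∀ Q : GridPath, Disjoint Q.points X.points → Disjoint Q.points Y.points →
        Disjoint Q.points B.points → ∀ z ∈ Q.points, ∀ z' ∈ Q.points, c z = c z') ∧
      ∀ i < n, ∀ j, n < j → j ≤ A.walk.length →
        c (A.walk.getVert i) ≠ c (A.walk.getVert j) := by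
  set p := A.walk.getVert n with hp
  have hpA : p ∈ A.points := A.getVert_mem n
  have endX : ∀ z ∈ A.points, z ∈ X.points → X.IsEnd z := fun z hz hz' =>
    (hAX.isEnd hz hz').resolve_left fun h => hXA z h hz'
  have endY : ∀ z ∈ A.points, z ∈ Y.points → Y.IsEnd z := fun z hz hz' =>
    (hAY.isEnd hz hz').resolve_left fun h => hYA z h hz'
  obtain ⟨r, hrX, hrB⟩ := hX
  obtain ⟨t, htY, htB⟩ := hY
  have hrA : r ∉ A.points := fun h => Set.disjoint_left.1 hAB h hrB
  have htA : t ∉ A.points := fun h => Set.disjoint_left.1 hAB h htB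
  obtain ⟨wX, hwX, hwXs, hwXe, hwXend⟩ := X.exists_path_of_isEnd (endX p hpA hnX) hrX
  obtain ⟨wY, hwY, hwYs, hwYe, hwYend⟩ := Y.exists_path_of_isEnd (endY p hpA hnY) htY
  obtain ⟨wB, hwBs, hwBe⟩ := B.exists_walk hrB htB
  -- The separating closed walk: from `p` along `X` to `B`, along `B`, and back to `p` along `Y`.
  set w := wX.append (wB.append wY.reverse) with hw
  have hsupp : ∀ z ∈ w.support, z ∈ wX.support ∨ z ∈ wB.support ∨ z ∈ wY.support := by
    intro z hz
    simpa [hw, Walk.mem_support_append_iff] using hz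
  -- Points of `X` or `Y` on `A` are endpoints of these paths, and the chosen parts of `X` and `Y`
  -- avoid the second endpoint.
  have hwA : ∀ z ∈ w.support, z ∈ A.points → z = p := by
    intro z hz hzA
    by_contra hne
    rcases hsupp z hz with h | h | h
    · exact hwXend z (endX z hzA (hwXs h)) hne (fun e => hrA (e ▸ hzA)) h
    · exact Set.disjoint_left.1 hAB hzA (hwBs h)
    · exact hwYend z (endY z hzA (hwYs h)) hne (fun e => htA (e ▸ hzA)) h
  have hwA' : ∀ k ≤ A.walk.length, k ≠ n → A.walk.getVert k ∉ w.support := fun k hk hkn h =>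
    hkn (A.getVert_inj hk hn (hwA _ h (A.getVert_mem k)))
  have hn0 : 0 < n := by
    rcases Nat.eq_zero_or_pos n with rfl | h
    · exact absurd hnX (hXA p (Or.inl (by simp [hp])))
    · exact h
  have hnl : n < A.walk.length := by
    rcases hn.lt_or_eq with h | rfl
    · exact h
    · exact absurd hnX (hXA p (Or.inr (by simp [hp])))
  obtain ⟨c, hc, hcross⟩ := exists_pointColoring w
  have hQ : ∀ Q : GridPath, Disjoint Q.points X.points → Disjoint Q.points Y.points →
      Disjoint Q.points B.points → ∀ z ∈ Q.points, z ∉ w.support := by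
    intro Q hQX hQY hQB z hz h
    rcases hsupp z h with h | h | h
    · exact Set.disjoint_left.1 hQX hz (hwXs h)
    · exact Set.disjoint_left.1 hQB hz (hwBs h)
    · exact Set.disjoint_left.1 hQY hz (hwYs h)
  refine ⟨c, ?_, ?_⟩
  · have key : ∀ Q : GridPath, Disjoint Q.points X.points → Disjoint Q.points Y.points →
        Disjoint Q.points B.points → ∀ z ∈ Q.points, c Q.start = c z := by
      intro Q hQX hQY hQB z hz
      obtain ⟨k, rfl, hk⟩ := Walk.mem_support_iff_exists_getVert.1 hz
      have := color_eq_of_disjoint (S := {z | z ∈ w.support}) hc Q (Nat.zero_le k) hk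
        fun l _ _ => hQ Q hQX hQY hQB _ (Q.getVert_mem l)
      rwa [Walk.getVert_zero] at this
    intro Q h1 h2 h3 z hz z' hz'
    rw [← key Q h1 h2 h3 z hz, key Q h1 h2 h3 z' hz']
  · intro i hi j hj hjl
    have h1 : c (A.walk.getVert i) = c (A.walk.getVert (n - 1)) :=
      color_eq_of_disjoint (S := {z | z ∈ w.support}) hc A (by omega) (by omega)
        fun k _ _ => hwA' k (by omega) (by omega)
    have h2 : c (A.walk.getVert (n + 1)) = c (A.walk.getVert j) :=
      color_eq_of_disjoint (S := {z | z ∈ w.support}) hc A (by omega) hjl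
        fun k _ _ => hwA' k (by omega) (by omega)
    rw [h1, ← h2]
    have hpr : p ≠ r := fun h => hrA (h ▸ hpA)
    have hprev := A.edge_mem (i := n - 1) (by omega)
    have hnext := A.edge_mem hnl
    have hadj := (A.walk.adj_getVert_succ (i := n - 1) (by omega)).symm
    rw [Nat.sub_add_cancel hn0, ← hp] at hprev hadj
    rw [← hp] at hnext
    cases hwXc : wX with
    | nil => exact absurd rfl hpr
    | @cons _ e _ he w' =>
      have hmem : s(p, e) ∈ wX.edges := by rw [hwXc]; simp
      have hmemX : s(p, e) ∈ X.edges := hwXe hmem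
      -- The first edge of `X` out of `p` is not an edge of `A`. The walk uses it exactly once,
      -- since `wX` is a path and neither `B` nor `Y` shares an edge with `X`.
      refine hcross p _ _ e hadj he hs ?_ ?_ (hwA' _ (by omega) (by omega))
        (hwA' _ (by omega) (by omega)) ?_
      · rintro rfl
        exact Set.disjoint_left.1 hAX.2 hprev (by rwa [Sym2.eq_swap])
      · rintro rfl
        exact Set.disjoint_left.1 hAX.2 hnext hmemX
      · rw [hw, Walk.edges_append, Walk.edges_append, List.count_append, List.count_append,
          List.count_eq_one_of_mem hwX.isTrail.edges_nodup hmem,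
          List.count_eq_zero_of_not_mem fun h => Set.disjoint_left.1 hBX.2 (hwBe h) hmemX,
          List.count_eq_zero_of_not_mem fun h => Set.disjoint_left.1 hXY.2 hmemX
            (hwYe (by simpa using h))]

/-- If five paths `u 0, …, u 4` touch cyclically, and not otherwise, and all of them touch two
disjoint paths `A` and `B`, then some two of them meet at a point of `A`, unless an endpoint of
`A` lies on one of them. -/
theorem exists_common_point {A B : GridPath} {u : Fin 5 → GridPath}
    (hA : ∀ i, (u i).InteriorlyDisjoint A) (hB : ∀ i, (u i).InteriorlyDisjoint B)
    (hu : ∀ i j, i ≠ j → (u i).InteriorlyDisjoint (u j)) (hAt : ∀ i, (u i).Touch A)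
    (hBt : ∀ i, (u i).Touch B) (hut : ∀ i, (u i).Touch (u (i + 1)))
    (hAB : Disjoint A.points B.points) (hud : ∀ i, Disjoint (u i).points (u (i + 2)).points)
    (hend : ∀ i z, A.IsEnd z → z ∉ (u i).points) :
    ∃ i, ∃ z ∈ A.points, z ∈ (u i).points ∧ z ∈ (u (i + 1)).points := by
  by_contra! hno
  -- The contact with `A` occupies one endpoint of `u i`, so at most one endpoint `ω i` is free to
  -- lie off `A`.
  have hω : ∀ i, ∃ ω, ∀ z, z ∉ A.points → (u i).IsEnd z → z = ω := by
    intro i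
    obtain ⟨z, hz, hzA⟩ := hAt i
    rcases (hA i).isEnd hz hzA with h | h
    · rcases h with rfl | rfl
      · exact ⟨(u i).finish, fun z hz h => h.resolve_left fun e => hz (e ▸ hzA)⟩
      · exact ⟨(u i).start, fun z hz h => h.resolve_right fun e => hz (e ▸ hzA)⟩
    · exact absurd hz (hend i z h)
  choose ω hω using hω
  choose c hc hc' using hut
  choose d hd hd' using hBt
  have hcA : ∀ i, c i ∉ A.points := fun i h => hno i _ h (hc i) (hc' i)
  have hdA : ∀ i, d i ∉ A.points := fun i h => Set.disjoint_left.1 hAB h (hd' i)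
  have hne : ∀ i : Fin 5, i ≠ i + 1 := by decide
  have hcω : ∀ i, ∃ k, (k = i ∨ k = i + 1) ∧ c i = ω k := fun i => by
    rcases (hu i (i + 1) (hne i)).isEnd (hc i) (hc' i) with h | h
    · exact ⟨i, Or.inl rfl, hω _ _ (hcA i) h⟩
    · exact ⟨i + 1, Or.inr rfl, hω _ _ (hcA i) h⟩
  choose f hf hcf using hcω
  have hnon : ∀ i j : Fin 5, (j = i + 2 ∨ i = j + 2) → ∀ z, z ∈ (u i).points → z ∉ (u j).points := by
    rintro i j (rfl | rfl) z hz hz'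
    · exact Set.disjoint_left.1 (hud _) hz hz'
    · exact Set.disjoint_left.1 (hud _) hz' hz
  -- Two equal contacts would lie on two non-consecutive rim paths, which are disjoint.
  have hcinj : Function.Injective c := by
    intro i j hij
    have key : ∀ i j : Fin 5, i = j ∨ (j = i + 2 ∨ i = j + 2) ∨
        j + 1 = i + 2 ∨ i + 1 = j + 2 := by decide
    rcases key i j with h | h | h | h
    · exact h
    · exact absurd (hij ▸ hc j) (hnon i j h _ (hc i))
    · exact absurd (hij ▸ hc' j) (hnon i (j + 1) (Or.inl h) _ (hc i))
    · exact absurd (hij ▸ hc' i) (hnon j (i + 1) (Or.inl h) _ (hc j))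
  -- The five distinct contacts use five distinct free endpoints, hence all of them.
  have hfinj : Function.Injective f := fun i j hij => hcinj (by rw [hcf, hcf, hij])
  have hfsurj : Function.Surjective f := Finite.surjective_of_injective hfinj
  have hωinj : Function.Injective ω := by
    intro i j hij
    obtain ⟨i, rfl⟩ := hfsurj i
    obtain ⟨j, rfl⟩ := hfsurj j
    rw [← hcf, ← hcf] at hij
    rw [hcinj hij]
  -- A contact with `B` at the free endpoint of `u i` is also a cyclic contact, so a second rim path
  -- passes through it. The free endpoint of that path is elsewhere, so the point must be an
  -- endpoint of `B`.
  have hdB : ∀ i, B.IsEnd (d i) := by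
    intro i
    rcases (hB i).isEnd (hd i) (hd' i) with h | h
    · have hdω := hω i _ (hdA i) h
      obtain ⟨k, rfl⟩ := hfsurj i
      -- the other path through this point
      obtain ⟨l, hl, hml⟩ : ∃ l, l ≠ f k ∧ c k ∈ (u l).points := by
        rcases hf k with h | h
        · exact ⟨k + 1, by rw [h]; exact (hne k).symm, hc' k⟩
        · exact ⟨k, by rw [h]; exact hne k, hc k⟩
      rw [← hcf] at hdω
      have hd2 := hd' (f k)
      rw [hdω] at hd2 ⊢
      refine ((hB l).isEnd hml hd2).resolve_left fun hend => hl ?_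
      exact hωinj (by rw [← hω l _ (hcA k) hend, hcf])
    · exact h
  -- The non-consecutive pairs form a 5-cycle again, which is not two-colourable.
  have hpigeon : ∀ β : Fin 5 → Bool, ∃ i j, (j = i + 2 ∨ i = j + 2) ∧ β i = β j := by decide
  obtain ⟨i, j, hij, h⟩ := hpigeon fun i => decide (d i = B.start)
  have hdij : d i = d j := by
    simp only [decide_eq_decide] at h
    by_cases hi : d i = B.start
    · rw [hi, h.1 hi]
    · rw [(hdB i).resolve_left hi, (hdB j).resolve_left (mt h.2 hi)]
  exact hnon i j hij _ (hd i) (hdij ▸ hd j)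

end GridPath


/-! ### The necklace graph -/

/-- The edges of a bead without its poles: a wheel with rim `0, …, 4` and hub `5`, and a pendant
vertex `6`. -/
def beadEdges : List (Fin 7 × Fin 7) :=
  [(0, 1), (1, 2), (2, 3), (3, 4), (4, 0), (0, 5), (1, 5), (2, 5), (3, 5), (4, 5), (2, 6)]

/-- The adjacency of the vertices of a bead. -/
def BeadAdj (x y : Fin 7) : Prop := (x, y) ∈ beadEdges ∨ (y, x) ∈ beadEdges

instance : DecidableRel BeadAdj := fun x y => by unfold BeadAdj; infer_instance

/-- The adjacency of the two poles to the vertices of a bead: the pole `false` is joined to the rim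
of the wheel, the pole `true` to the pendant vertex. -/
def PoleAdj (p : Bool) (x : Fin 7) : Prop := if p then x = 6 else x < 5

instance : DecidableRel PoleAdj := fun p x => by unfold PoleAdj; infer_instance

/-- The vertices of the necklace graph: the vertices of `m` beads, and two poles. -/
abbrev NecklaceVertex (m : ℕ) : Type := Fin m × Fin 7 ⊕ Bool

/-- The adjacency of the necklace graph. -/
def NecklaceAdj (m : ℕ) : NecklaceVertex m → NecklaceVertex m → Prop
  | .inl (i, x), .inl (j, y) => i = j ∧ BeadAdj x y
  | .inl (_, x), .inr p => PoleAdj p x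
  | .inr p, .inl (_, x) => PoleAdj p x
  | .inr _, .inr _ => False

/-- `m` copies of the pentagonal bipyramid that have one apex in common, tied together by a further
vertex that is linked to all of them by paths of length two. -/
def necklace (m : ℕ) : SimpleGraph (NecklaceVertex m) where
  Adj := NecklaceAdj m
  symm := ⟨by
    rintro (⟨i, x⟩ | p) (⟨j, y⟩ | q) h
    · exact ⟨h.1.symm, h.2.symm⟩
    · exact h
    · exact h
    · exact h⟩
  loopless := ⟨by
    have : ∀ x, ¬ BeadAdj x x := by decide
    rintro (⟨i, x⟩ | p) h
    · exact this x h.2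
    · exact h⟩

theorem Representation.disjoint_points {V : Type*} {G : SimpleGraph V} (R : Representation G)
    {u v : V} (huv : u ≠ v) (h : ¬ G.Adj u v) : Disjoint (R.path u).points (R.path v).points := by
  rw [R.adj_iff u v huv, GridPath.Touch, Set.not_nonempty_iff_eq_empty] at h
  exact Set.disjoint_iff_inter_eq_empty.2 h

theorem Representation.touch {V : Type*} {G : SimpleGraph V} (R : Representation G)
    {u v : V} (h : G.Adj u v) : (R.path u).Touch (R.path v) :=
  (R.adj_iff u v h.ne).1 h

/-! ### The lower bound on the bends of the first pole -/

section LowerBound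

variable {m : ℕ} (R : Representation (necklace m))

/-- The path of a vertex of the rim of a bead. -/
abbrev rimPath (i : Fin m) (x : Fin 5) : GridPath := R.path (.inl (i, x.castLE (by decide)))

theorem disjoint_of_ne_bead {i j : Fin m} (h : i ≠ j) (x y : Fin 7) :
    Disjoint (R.path (.inl (i, x))).points (R.path (.inl (j, y))).points :=
  R.disjoint_points (by simp [h]) fun h' => h h'.1

/-- The path of the first pole bends at a point of the rim of the bead `i`. -/
def BendsAtBead (i : Fin m) : Prop :=
  let A := R.path (.inr false)
  ∃ n ∈ Finset.Ioo 0 A.walk.length, A.walk.getVert (n + 1) - A.walk.getVert n ≠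
    A.walk.getVert n - A.walk.getVert (n - 1) ∧ ∃ x, A.walk.getVert n ∈ (rimPath R i x).points

/-- The path of the first pole meets the rim of the bead `i` before those of the other beads. -/
def BeadComesFirst (i : Fin m) : Prop :=
  let A := R.path (.inr false)
  ∃ n ≤ A.walk.length, (∃ x, A.walk.getVert n ∈ (rimPath R i x).points) ∧
    ∀ j ≠ i, ∀ x, ∀ k ≤ A.walk.length, A.walk.getVert k ∈ (rimPath R j x).points → n < k

/-- The path of the first pole meets the rim of the bead `i` after those of the other beads. -/
def BeadComesLast (i : Fin m) : Prop :=
  let A := R.path (.inr false)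
  ∃ n ≤ A.walk.length, (∃ x, A.walk.getVert n ∈ (rimPath R i x).points) ∧
    ∀ j ≠ i, ∀ x, ∀ k ≤ A.walk.length, A.walk.getVert k ∈ (rimPath R j x).points → k < n

/-- An endpoint of `A` on the rim makes the bead extremal at once. Otherwise two consecutive rim
paths end at a common interior point of `A`. If `A` is straight there, the separating colouring puts
the contacts of all other beads on one side. -/
theorem bead_bend_or_first_or_last (i : Fin m) :
    BendsAtBead R i ∨ BeadComesFirst R i ∨ BeadComesLast R i := by
  set A := R.path (.inr false)
  have hne : ∀ j ≠ i, ∀ x y z, z ∈ (rimPath R i x).points → z ∉ (rimPath R j y).points :=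
    fun j hj x y z h h' => Set.disjoint_left.1 (disjoint_of_ne_bead R hj.symm _ _) h h'
  by_cases hend : ∃ x z, A.IsEnd z ∧ z ∈ (rimPath R i x).points
  · obtain ⟨x, z, rfl | rfl, hz⟩ := hend
    · refine Or.inr (Or.inl ⟨0, Nat.zero_le _, ⟨x, by simpa using hz⟩, fun j hj y k _ hk' => ?_⟩)
      rcases Nat.eq_zero_or_pos k with rfl | h
      · exact absurd (by simpa using hk') (hne j hj x y _ hz)
      · exact h
    · refine Or.inr (Or.inr ⟨_, le_rfl, ⟨x, by simpa using hz⟩, fun j hj y k hk hk' => ?_⟩)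
      rcases hk.lt_or_eq with h | rfl
      · exact h
      · exact absurd (by simpa using hk') (hne j hj x y _ hz)
  push Not at hend
  replace hend : ∀ x z, A.IsEnd z → z ∉ (rimPath R i x).points := hend
  set B := R.path (.inl (i, 5)) with hB
  have f1 : ∀ x : Fin 5, BeadAdj (x.castLE (by decide)) ((x + 1).castLE (by decide)) := by decide
  have f2 : ∀ x : Fin 5, ¬ BeadAdj (x.castLE (by decide)) ((x + 2).castLE (by decide)) := by decide
  have f3 : ∀ x : Fin 5, BeadAdj (x.castLE (by decide)) 5 := by decide
  have f4 : ∀ x : Fin 5, PoleAdj false (x.castLE (by decide)) := by decide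
  have f5 : ∀ x : Fin 5, (x.castLE (by decide) : Fin 7) ≠ 5 := by decide
  have f8 : ∀ x : Fin 5, ¬ PoleAdj true (x.castLE (by decide)) := by decide
  have f6 : ∀ x : Fin 5, x ≠ x + 1 := by decide
  have f7 : ∀ x : Fin 5, x ≠ x + 2 := by decide
  have hcast : ∀ x y : Fin 5, x ≠ y → (x.castLE (by decide) : Fin 7) ≠ y.castLE (by decide) :=
    fun x y h h' => h (Fin.castLE_injective _ h')
  have hAB : Disjoint A.points B.points :=
    R.disjoint_points (by simp) fun h : PoleAdj false 5 => by revert h; decide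
  have hAu : ∀ x, A.InteriorlyDisjoint (rimPath R i x) := fun x =>
    R.interiorlyDisjoint _ _ (by simp)
  have hBu : ∀ x, B.InteriorlyDisjoint (rimPath R i x) := fun x =>
    R.interiorlyDisjoint _ _ (by simpa using (f5 x).symm)
  have huu : ∀ x y, x ≠ y → (rimPath R i x).InteriorlyDisjoint (rimPath R i y) := fun x y h =>
    R.interiorlyDisjoint _ _ (by simpa using hcast x y h)
  have hBt : ∀ j x, (rimPath R j x).Touch (R.path (.inl (j, 5))) := fun j x =>
    R.touch ⟨rfl, f3 x⟩
  obtain ⟨x, z, hzA, hzx, hzy⟩ := GridPath.exists_common_point (fun x => (hAu x).symm)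
    (fun x => (hBu x).symm) huu (fun x => R.touch (f4 x)) (hBt i)
    (fun x => R.touch ⟨rfl, f1 x⟩) hAB
    (fun x => R.disjoint_points (by simp) fun h => f2 x h.2) hend
  obtain ⟨n, rfl, hn⟩ := Walk.mem_support_iff_exists_getVert.1 hzA
  by_cases hs : A.walk.getVert (n + 1) - A.walk.getVert n ≠
      A.walk.getVert n - A.walk.getVert (n - 1)
  -- The position is interior because the endpoints of `A` avoid the rim.
  · refine Or.inl ⟨n, Finset.mem_Ioo.2 ⟨?_, ?_⟩, hs, x, hzx⟩
    · rcases Nat.eq_zero_or_pos n with rfl | h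
      · exact absurd hzx (hend x _ (Or.inl (by simp)))
      · exact h
    · rcases hn.lt_or_eq with h | rfl
      · exact h
      · exact absurd hzx (hend x _ (Or.inr (by simp)))
  · obtain ⟨c, hc, hcA⟩ := GridPath.exists_separating_coloring (hAu x) (hAu (x + 1))
      (huu _ _ (f6 x)) (hBu x) hAB (hBt i x) (hBt i (x + 1)) (hend x) (hend (x + 1)) hn hzx hzy
      (not_not.1 hs)
    set T := R.path (.inr true) with hT
    have hcT : ∀ z ∈ T.points, ∀ z' ∈ T.points, c z = c z' := by
      refine hc T ?_ ?_ ?_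
      · exact R.disjoint_points (by simp) fun h => f8 _ h
      · exact R.disjoint_points (by simp) fun h => f8 _ h
      · exact R.disjoint_points (by simp) fun h : PoleAdj true 5 => by revert h; decide
    have hcj : ∀ j ≠ i, ∀ y, ∀ z ∈ (R.path (.inl (j, y))).points,
        ∀ z' ∈ (R.path (.inl (j, y))).points, c z = c z' := fun j hj y =>
      hc _ (disjoint_of_ne_bead R hj _ _) (disjoint_of_ne_bead R hj _ _)
        (disjoint_of_ne_bead R hj _ _)
    -- The colour is carried along touching paths from a rim path through the hub, the rim vertex
    -- `2` and the pendant vertex to the pole `true`; none of these paths meets the separating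
    -- curve.
    have hcR : ∀ j ≠ i, ∀ y, ∀ z ∈ (rimPath R j y).points, c z = c T.start := by
      intro j hj y z hz
      obtain ⟨z1, h1, h1'⟩ := hBt j y
      obtain ⟨z2, h2, h2'⟩ := hBt j 2
      obtain ⟨z3, h3, h3'⟩ := R.touch (u := .inl (j, 2)) (v := .inl (j, 6)) ⟨rfl, by decide⟩
      obtain ⟨z4, h4, h4'⟩ := R.touch (u := .inl (j, 6)) (v := .inr true)
        (show PoleAdj true 6 by decide)
      rw [hcj j hj _ z hz z1 h1, hcj j hj _ z1 h1' z2 h2', hcj j hj 2 z2 h2 z3 h3,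
        hcj j hj _ z3 h3' z4 h4, hcT z4 h4' _ T.start_mem]
    have hnk : ∀ j ≠ i, ∀ y k, A.walk.getVert k ∈ (rimPath R j y).points → k ≠ n := by
      rintro j hj y k hk rfl
      exact hne j hj x y _ hzx hk
    -- Contacts on both sides of position `n` would have different colours, but all of them have the
    -- colour of `T`.
    by_cases hfirst : ∃ j ≠ i, ∃ y, ∃ k < n, A.walk.getVert k ∈ (rimPath R j y).points
    · obtain ⟨j, hj, y, k, hkn, hk⟩ := hfirst
      refine Or.inr (Or.inr ⟨n, hn, ⟨x, hzx⟩, fun j' hj' y' k' hkl hk' => ?_⟩)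
      by_contra hlt
      refine hcA k hkn k' (by have := hnk j' hj' y' k' hk'; omega) hkl ?_
      rw [hcR j hj y _ hk, hcR j' hj' y' _ hk']
    · push Not at hfirst
      refine Or.inr (Or.inl ⟨n, hn, ⟨x, hzx⟩, fun j hj y k hkl hk => ?_⟩)
      by_contra hlt
      exact hfirst j hj y k (by have := hnk j hj y k hk; omega) hk

/-- In every CPG representation of a necklace, the path of the first pole has at least as many
bends as there are beads, up to two. -/
theorem necklace_le_bends : m ≤ (R.path (.inr false)).bends + 2 := by
  classical
  set A := R.path (.inr false) with hA
  have key := bead_bend_or_first_or_last R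
  have hcard : (Finset.univ : Finset (Fin m)).card ≤ _ := Finset.card_le_card
    (t := Finset.univ.filter (BendsAtBead R) ∪ (Finset.univ.filter (BeadComesFirst R) ∪ Finset.univ.filter (BeadComesLast R)))
    fun i _ => by simpa using key i
  have h2 : (Finset.univ.filter (BeadComesFirst R)).card ≤ 1 := by
    refine Finset.card_le_one.2 fun i hi j hj => ?_
    obtain ⟨n, hn, ⟨x, hx⟩, h⟩ := (Finset.mem_filter.1 hi).2
    obtain ⟨n', hn', ⟨x', hx'⟩, h'⟩ := (Finset.mem_filter.1 hj).2
    by_contra hij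
    exact lt_asymm (h j (Ne.symm hij) x' n' hn' hx') (h' i hij x n hn hx)
  have h3 : (Finset.univ.filter (BeadComesLast R)).card ≤ 1 := by
    refine Finset.card_le_one.2 fun i hi j hj => ?_
    obtain ⟨n, hn, ⟨x, hx⟩, h⟩ := (Finset.mem_filter.1 hi).2
    obtain ⟨n', hn', ⟨x', hx'⟩, h'⟩ := (Finset.mem_filter.1 hj).2
    by_contra hij
    exact lt_asymm (h j (Ne.symm hij) x' n' hn' hx') (h' i hij x n hn hx)
  have h1 : (Finset.univ.filter (BendsAtBead R)).card ≤ A.bends := by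
    have : ∀ i, ∃ n, BendsAtBead R i → n ∈ (Finset.Ioo 0 A.walk.length).filter (fun n =>
        A.walk.getVert (n + 1) - A.walk.getVert n ≠ A.walk.getVert n - A.walk.getVert (n - 1)) ∧
        ∃ x, A.walk.getVert n ∈ (rimPath R i x).points := fun i => by
      by_cases h : BendsAtBead R i
      · obtain ⟨n, hn, hb, hx⟩ := h
        exact ⟨n, fun _ => ⟨Finset.mem_filter.2 ⟨hn, hb⟩, hx⟩⟩
      · exact ⟨0, fun h' => absurd h' h⟩
    choose f hf using this
    refine Finset.card_le_card_of_injOn f (fun i hi => (hf i (Finset.mem_filter.1 hi).2).1) ?_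
    intro i hi j hj hij
    obtain ⟨x, hx⟩ := (hf i (Finset.mem_filter.1 hi).2).2
    obtain ⟨y, hy⟩ := (hf j (Finset.mem_filter.1 hj).2).2
    -- One bend cannot serve two beads, as the rims of different beads are disjoint.
    by_contra hne
    rw [hij] at hx
    exact Set.disjoint_left.1 (disjoint_of_ne_bead R hne _ _) hx hy
  have h4 := Finset.card_union_le (Finset.univ.filter (BendsAtBead R))
    (Finset.univ.filter (BeadComesFirst R) ∪ Finset.univ.filter (BeadComesLast R))
  have h5 := Finset.card_union_le (Finset.univ.filter (BeadComesFirst R)) (Finset.univ.filter (BeadComesLast R))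
  rw [Finset.card_univ, Fintype.card_fin] at hcard
  omega

end LowerBound


/-! ### Straight paths and the book: the case of no bends -/

namespace GridPath

theorem length_pos (P : GridPath) : 0 < P.walk.length := by
  rcases Nat.eq_zero_or_pos P.walk.length with h | h
  · exact absurd (Walk.eq_of_length_eq_zero h) P.start_ne_finish
  · exact h

/-- A path without bends is a segment, and hence a box. -/
theorem exists_points_eq_of_bends_eq_zero (P : GridPath) (h : P.bends = 0) :
    ∃ x₁ x₂ y₁ y₂ : ℤ, P.points = {p | (x₁ ≤ p.1 ∧ p.1 ≤ x₂) ∧ y₁ ≤ p.2 ∧ p.2 ≤ y₂} := by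
  set d := P.walk.getVert 1 - P.walk.getVert 0 with hd
  have hstep : ∀ i < P.walk.length, P.walk.getVert (i + 1) - P.walk.getVert i = d := by
    intro i hi
    induction i with
    | zero => rfl
    | succ i ih =>
      rw [← ih (by omega)]
      rw [bends, Finset.card_eq_zero, Finset.filter_eq_empty_iff] at h
      simpa using h (x := i + 1) (Finset.mem_Ioo.2 ⟨by omega, hi⟩)
  have hpos : ∀ i ≤ P.walk.length, P.walk.getVert i = P.start + (i * d.1, i * d.2) := by
    intro i hi
    induction i with
    | zero => ext <;> simp
    | succ i ih =>
      have := hstep i (by omega)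
      rw [sub_eq_iff_eq_add, ih (by omega)] at this
      rw [this]
      ext <;> simp <;> ring
  have hpts : P.points = {p | ∃ i : ℕ, i ≤ P.walk.length ∧ p = P.start + (i * d.1, i * d.2)} := by
    ext p
    refine Walk.mem_support_iff_exists_getVert.trans ⟨?_, ?_⟩
    · rintro ⟨i, rfl, hi⟩
      exact ⟨i, hi, hpos i hi⟩
    · rintro ⟨i, hi, rfl⟩
      exact ⟨i, hpos i hi, hi⟩
  have hadj := P.walk.adj_getVert_succ P.length_pos
  have hd' : (d.2 = 0 ∧ (d.1 = 1 ∨ d.1 = -1)) ∨ (d.1 = 0 ∧ (d.2 = 1 ∨ d.2 = -1)) := by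
    simp only [hd, Prod.fst_sub, Prod.snd_sub]
    rcases hadj with ⟨h, h' | h'⟩ | ⟨h, h' | h'⟩ <;> simp only [zero_add] at h h' <;> omega
  set n := P.walk.length
  set a := P.start.1 with ha
  set b := P.start.2 with hb
  rw [hpts]
  rcases hd' with ⟨h, h' | h'⟩ | ⟨h, h' | h'⟩ <;> rw [h, h']
  · refine ⟨a, a + n, b, b, ?_⟩
    ext ⟨x, y⟩
    simp only [Set.mem_ofPred_eq, Prod.ext_iff, Prod.fst_add, Prod.snd_add]
    exact ⟨fun ⟨i, hi, h⟩ => by omega, fun h => ⟨(x - a).toNat, by omega, by omega, by omega⟩⟩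
  · refine ⟨a - n, a, b, b, ?_⟩
    ext ⟨x, y⟩
    simp only [Set.mem_ofPred_eq, Prod.ext_iff, Prod.fst_add, Prod.snd_add]
    exact ⟨fun ⟨i, hi, h⟩ => by omega, fun h => ⟨(a - x).toNat, by omega, by omega, by omega⟩⟩
  · refine ⟨a, a, b, b + n, ?_⟩
    ext ⟨x, y⟩
    simp only [Set.mem_ofPred_eq, Prod.ext_iff, Prod.fst_add, Prod.snd_add]
    exact ⟨fun ⟨i, hi, h⟩ => by omega, fun h => ⟨(y - b).toNat, by omega, by omega, by omega⟩⟩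
  · refine ⟨a, a, b - n, b, ?_⟩
    ext ⟨x, y⟩
    simp only [Set.mem_ofPred_eq, Prod.ext_iff, Prod.fst_add, Prod.snd_add]
    exact ⟨fun ⟨i, hi, h⟩ => by omega, fun h => ⟨(b - y).toNat, by omega, by omega, by omega⟩⟩

/-- Three straight paths that touch pairwise have a common point. -/
theorem exists_common_point_of_bends_eq_zero {P Q R : GridPath} (hP : P.bends = 0)
    (hQ : Q.bends = 0) (hR : R.bends = 0) (hPQ : P.Touch Q) (hPR : P.Touch R) (hQR : Q.Touch R) :
    ∃ z, z ∈ P.points ∧ z ∈ Q.points ∧ z ∈ R.points := by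
  obtain ⟨a₁, a₂, a₃, a₄, ha⟩ := P.exists_points_eq_of_bends_eq_zero hP
  obtain ⟨b₁, b₂, b₃, b₄, hb⟩ := Q.exists_points_eq_of_bends_eq_zero hQ
  obtain ⟨c₁, c₂, c₃, c₄, hc⟩ := R.exists_points_eq_of_bends_eq_zero hR
  obtain ⟨p, hp, hp'⟩ := hPQ
  obtain ⟨q, hq, hq'⟩ := hPR
  obtain ⟨r, hr, hr'⟩ := hQR
  rw [ha] at hp hq ⊢
  rw [hb] at hp' hr ⊢
  rw [hc] at hq' hr' ⊢
  simp only [Set.mem_ofPred_eq] at *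
  -- Helly's theorem for intervals, in each coordinate: the largest lower bound lies in all three.
  exact ⟨(max a₁ (max b₁ c₁), max a₃ (max b₃ c₃)), by omega, by omega, by omega⟩

theorem exists_edge_mem (P : GridPath) {z : ℤ × ℤ} (hz : z ∈ P.points) :
    ∃ q, grid.Adj z q ∧ s(z, q) ∈ P.edges := by
  obtain ⟨i, rfl, hi⟩ := Walk.mem_support_iff_exists_getVert.1 hz
  rcases hi.lt_or_eq with h | rfl
  · exact ⟨_, P.walk.adj_getVert_succ h, P.edge_mem h⟩
  · have h : P.walk.length - 1 < P.walk.length := by have := P.length_pos; omega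
    have h1 := P.walk.adj_getVert_succ h
    have h2 := P.edge_mem h
    rw [Nat.sub_add_cancel P.length_pos] at h1 h2
    exact ⟨_, h1.symm, by rwa [Sym2.eq_swap]⟩

/-- At most four pairwise interiorly disjoint paths meet at a point. -/
theorem card_le_four {ι : Type*} (s : Finset ι) (P : ι → GridPath)
    (h : ∀ i ∈ s, ∀ j ∈ s, i ≠ j → (P i).InteriorlyDisjoint (P j)) (z : ℤ × ℤ)
    (hz : ∀ i ∈ s, z ∈ (P i).points) : s.card ≤ 4 := by
  classical
  have : ∀ i, ∃ q, i ∈ s → grid.Adj z q ∧ s(z, q) ∈ (P i).edges := fun i => by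
    by_cases hi : i ∈ s
    · obtain ⟨q, hq⟩ := (P i).exists_edge_mem (hz i hi)
      exact ⟨q, fun _ => hq⟩
    · exact ⟨z, fun h => absurd h hi⟩
  choose f hf using this
  let N : Finset (ℤ × ℤ) := {(z.1 + 1, z.2), (z.1 - 1, z.2), (z.1, z.2 + 1), (z.1, z.2 - 1)}
  refine (Finset.card_le_card_of_injOn (t := N) f (fun i hi => ?_) fun i hi j hj hij => ?_).trans
    Finset.card_le_four
  · have := (hf i hi).1
    simp only [N, Finset.coe_insert, Finset.coe_singleton, Set.mem_insert_iff,
      Set.mem_singleton_iff, Prod.ext_iff]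
    rcases this with ⟨h, h' | h'⟩ | ⟨h, h' | h'⟩ <;> omega
  · by_contra hne
    exact Set.disjoint_left.1 (h i hi j hj hne).2 (hf i hi).2 (hij ▸ (hf j hj).2)

end GridPath

/-- The graph that consists of `n` triangles with a common edge. -/
def book (n : ℕ) : SimpleGraph (Fin n ⊕ Bool) where
  Adj
    | .inl _, .inl _ => False
    | .inl _, .inr _ => True
    | .inr _, .inl _ => True
    | .inr p, .inr q => p ≠ q
  symm := ⟨by
    rintro (i | p) (j | q) h
    · exact h
    · trivial
    · trivial
    · exact Ne.symm h⟩
  loopless := ⟨by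
    rintro (i | p) h
    · exact h
    · exact h rfl⟩

/-- By the Helly property each page passes through a common point of the two spine paths, which is
one of their at most four endpoints. Too many pages then share a point, where only four grid-edges
are available. -/
theorem not_isBendCPG_zero_book : ¬ IsBendCPG 0 (book 9) := by
  classical
  rintro ⟨R, hR⟩
  replace hR : ∀ v, (R.path v).bends = 0 := fun v => Nat.le_zero.1 (hR v)
  set A := R.path (.inr false) with hA
  set B := R.path (.inr true) with hB
  have hz : ∀ i, ∃ z, z ∈ A.points ∧ z ∈ B.points ∧ z ∈ (R.path (.inl i)).points := fun i =>
    GridPath.exists_common_point_of_bends_eq_zero (hR _) (hR _) (hR _)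
      (R.touch (u := .inr false) (v := .inr true) (by simp [book]))
      (R.touch (u := .inr false) (v := .inl i) trivial)
      (R.touch (u := .inr true) (v := .inl i) trivial)
  choose z hzA hzB hz using hz
  let E : Finset (ℤ × ℤ) := {A.start, A.finish, B.start, B.finish}
  have hzE : ∀ i ∈ (Finset.univ : Finset (Fin 9)), z i ∈ E := fun i _ => by
    have := (R.interiorlyDisjoint (.inr false) (.inr true) (by simp)).isEnd (hzA i) (hzB i)
    simp only [E, Finset.mem_insert, Finset.mem_singleton]
    rcases this with (h | h) | (h | h) <;> simp [h, hA, hB]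
  -- Since `9 > 2 * 4`, some endpoint carries at least three pages; with the two spine paths this
  -- makes five.
  obtain ⟨p, -, hp⟩ := Finset.exists_lt_card_fiber_of_mul_lt_card_of_maps_to (n := 2) hzE (by
    have : E.card ≤ 4 := Finset.card_le_four
    simp only [Finset.card_univ, Fintype.card_fin]; omega)
  obtain ⟨i, hi⟩ := Finset.card_pos.1 (by omega : 0 < (Finset.univ.filter (z · = p)).card)
  have hi : z i = p := (Finset.mem_filter.1 hi).2
  have := GridPath.card_le_four ((Finset.univ.filter (z · = p)).disjSum Finset.univ) R.path
    (fun u _ v _ huv => R.interiorlyDisjoint u v huv) p (by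
      rintro (j | q) h
      · rw [Finset.inl_mem_disjSum, Finset.mem_filter] at h
        exact h.2 ▸ hz j
      · cases q
        · exact hi ▸ hzA i
        · exact hi ▸ hzB i)
  rw [Finset.card_disjSum, Finset.card_univ, Fintype.card_bool] at this
  omega


/-! ### Planarity by straight-line drawings -/

/-- The degree condition `hdeg` keeps vertices out of the interiors of edges: of two different edges
at `v`, at least one differs from a given edge through `pos v`, and disjointness of segments applies
to it. -/
theorem isPlanar_of_disjoint_segments {V : Type*} {G : SimpleGraph V} (pos : V → ℝ × ℝ)
    (hpos : Function.Injective pos) (hdeg : ∀ v, ∃ x y, x ≠ y ∧ G.Adj v x ∧ G.Adj v y)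
    (h : ∀ u v u' v', G.Adj u v → G.Adj u' v' → s(u, v) ≠ s(u', v') →
      Disjoint (openSegment ℝ (pos u) (pos v)) (segment ℝ (pos u') (pos v'))) :
    IsPlanar G := by
  have hout : ∀ e : G.edgeSet, ∃ p : V × V, s(p.1, p.2) = e.1 := fun e => by
    obtain ⟨e, he⟩ := e
    induction e with
    | _ u v => exact ⟨(u, v), rfl⟩
  choose p hp using hout
  have hadj : ∀ e, G.Adj (p e).1 (p e).2 := fun e => by
    rw [← mem_edgeSet, hp e]; exact e.2
  have hopen : ∀ (u v : V) (t : unitInterval), t ≠ 0 → t ≠ 1 →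
      AffineMap.lineMap (pos u) (pos v) (t : ℝ) ∈ openSegment ℝ (pos u) (pos v) := by
    intro u v t h0 h1
    rw [openSegment_eq_image_lineMap]
    exact ⟨t, ⟨t.2.1.lt_of_ne fun h => h0 (Subtype.ext h.symm),
      t.2.2.lt_of_ne fun h => h1 (Subtype.ext h)⟩, rfl⟩
  have hclosed : ∀ (u v : V) (t : unitInterval),
      AffineMap.lineMap (pos u) (pos v) (t : ℝ) ∈ segment ℝ (pos u) (pos v) := by
    intro u v t
    rw [segment_eq_image_lineMap]
    exact ⟨t, t.2, rfl⟩
  refine ⟨{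
    pos := pos
    pos_injective := hpos
    arc := fun e t => AffineMap.lineMap (pos (p e).1) (pos (p e).2) (t : ℝ)
    arc_continuous := fun e => AffineMap.lineMap_continuous.comp continuous_subtype_val
    arc_injective := fun e s t hst => Subtype.ext
      (AffineMap.lineMap_injective ℝ (fun h => (hadj e).ne (hpos h)) hst)
    arc_ends := fun e => by rw [← hp e]; simp
    arc_ne_pos := ?_
    arc_ne_arc := ?_ }⟩
  · intro e t h0 h1 v hv
    obtain ⟨x, y, hxy, hx, hy⟩ := hdeg v
    have key : ∀ w, G.Adj v w → s((p e).1, (p e).2) = s(v, w) := by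
      intro w hw
      by_contra hne
      refine Set.disjoint_left.1 (h _ _ _ _ (hadj e) hw hne) (hopen _ _ t h0 h1) ?_
      rw [hv]
      exact left_mem_segment ℝ _ _
    have := (key x hx).symm.trans (key y hy)
    simp only [Sym2.eq_iff] at this
    rcases this with h | h
    · exact hxy h.2
    · exact hx.ne h.2.symm
  · intro e f hef t h0 h1 s hts
    refine Set.disjoint_left.1 (h _ _ _ _ (hadj e) (hadj f) ?_) (hopen _ _ t h0 h1)
      (hts ▸ hclosed _ _ s)
    rw [hp, hp]
    exact fun h => hef (Subtype.ext h)

theorem IsPlanar.comap {V W : Type*} {G : SimpleGraph V} (h : IsPlanar G) (f : W ↪ V) :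
    IsPlanar (G.comap f) := by
  obtain ⟨E⟩ := h
  have hmem : ∀ e : (G.comap f).edgeSet, Sym2.map f e ∈ G.edgeSet := by
    rintro ⟨e, he⟩
    induction e with
    | _ u v => exact he
  refine ⟨{
    pos := E.pos ∘ f
    pos_injective := E.pos_injective.comp f.injective
    arc := fun e => E.arc ⟨_, hmem e⟩
    arc_continuous := fun e => E.arc_continuous _
    arc_injective := fun e => E.arc_injective _
    arc_ends := fun e => by rw [E.arc_ends, Sym2.map_map]
    arc_ne_pos := fun e t h0 h1 v => E.arc_ne_pos _ t h0 h1 _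
    arc_ne_arc := fun e e' hne t h0 h1 s => E.arc_ne_arc _ _ (fun h => hne ?_) t h0 h1 s }⟩
  exact Subtype.ext (Sym2.map.injective f.injective (Subtype.ext_iff.1 h))

/-- Twice the signed area of a triangle. -/
def area (p q r : ℤ × ℤ) : ℤ := (q.1 - p.1) * (r.2 - p.2) - (q.2 - p.2) * (r.1 - p.1)

/-- One of the segments `pq` and `rs` lies on one side of the line through the other one, such that
no point of `rs` is an interior point of `pq`. -/
def Separated (p q r s : ℤ × ℤ) : Prop :=
  (0 ≤ area r s p ∧ 0 ≤ area r s q ∧ 0 < area r s p + area r s q) ∨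
  (area r s p ≤ 0 ∧ area r s q ≤ 0 ∧ area r s p + area r s q < 0) ∨
  (0 < area p q r ∧ 0 < area p q s) ∨ (area p q r < 0 ∧ area p q s < 0)

instance (p q r s : ℤ × ℤ) : Decidable (Separated p q r s) := by unfold Separated; infer_instance

/-- The point of the plane with given integer coordinates. -/
def realPoint (p : ℤ × ℤ) : ℝ × ℝ := (p.1, p.2)

/-- At a common point both line functions vanish, each being a weighted mean of its values at the
ends of the other segment. On the open segment both weights are positive, so one strict sign
suffices; on the closed one a weight may be zero, so both signs must be strict. -/
theorem Separated.disjoint {p q r s : ℤ × ℤ} (h : Separated p q r s) :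
    Disjoint (openSegment ℝ (realPoint p) (realPoint q))
      (segment ℝ (realPoint r) (realPoint s)) := by
  rw [Set.disjoint_left]
  rintro z ⟨a, b, ha, hb, hab, rfl⟩ ⟨c, d, hc, hd, hcd, hz⟩
  simp only [realPoint, Prod.smul_mk, Prod.mk_add_mk, smul_eq_mul, Prod.mk.injEq] at hz
  obtain ⟨h1, h2⟩ := hz
  obtain rfl : a = 1 - b := by linarith
  obtain rfl : c = 1 - d := by linarith
  have e1 : (1 - b) * (area r s p : ℝ) + b * (area r s q : ℝ) = 0 := by
    simp only [area]; push_cast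
    linear_combination ((s.2 : ℝ) - r.2) * h1 - ((s.1 : ℝ) - r.1) * h2
  have e2 : (1 - d) * (area p q r : ℝ) + d * (area p q s : ℝ) = 0 := by
    simp only [area]; push_cast
    linear_combination ((q.1 : ℝ) - p.1) * h2 - ((q.2 : ℝ) - p.2) * h1
  have hpos : ∀ x y : ℤ, 0 ≤ x → 0 ≤ y → 0 < x + y → (1 - b) * (x : ℝ) + b * (y : ℝ) ≠ 0 := by
    intro x y hx hy hxy
    rcases hx.lt_or_eq with h | rfl
    · have : (0 : ℝ) < x := by exact_mod_cast h
      have : (0 : ℝ) ≤ y := by exact_mod_cast hy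
      positivity
    · have : (0 : ℝ) < y := by exact_mod_cast (by omega : 0 < y)
      simp only [Int.cast_zero, mul_zero, zero_add]
      positivity
  have hpos' : ∀ x y : ℤ, 0 < x → 0 < y → (1 - d) * (x : ℝ) + d * (y : ℝ) ≠ 0 := by
    intro x y hx hy
    have hx : (0 : ℝ) < x := by exact_mod_cast hx
    have hy : (0 : ℝ) < y := by exact_mod_cast hy
    rcases hd.lt_or_eq with h | rfl
    · positivity
    · simpa using hx.ne'
  rcases h with ⟨h1, h2, h3⟩ | ⟨h1, h2, h3⟩ | ⟨h1, h2⟩ | ⟨h1, h2⟩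
  · exact hpos _ _ h1 h2 h3 e1
  · refine hpos (-area r s p) (-area r s q) (by omega) (by omega) (by omega) ?_
    push_cast; linarith
  · exact hpos' _ _ h1 h2 e2
  · refine hpos' (-area p q r) (-area p q s) (by omega) (by omega) ?_
    push_cast; linarith

/-! #### Books -/

/-- A straight-line drawing of a book. -/
def bookPosition {n : ℕ} : Fin n ⊕ Bool → ℤ × ℤ
  | .inl i => (i + 1, 0)
  | .inr p => (0, if p then 1 else -1)

theorem isPlanar_book {n : ℕ} (hn : 1 < n) : IsPlanar (book n) := by
  have cast_ne : ∀ i j : Fin n, i ≠ j → (i : ℤ) < j ∨ (j : ℤ) < i := fun i j h => by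
    have : (i : ℕ) ≠ j := fun e => h (Fin.ext e)
    omega
  refine isPlanar_of_disjoint_segments (fun v => realPoint (bookPosition v)) ?_ ?_ ?_
  · rintro (i | p) (j | q) h <;> simp only [realPoint, bookPosition, Prod.mk.injEq] at h
    · have h := h.1
      norm_cast at h
      exact congrArg _ (Fin.ext (by omega))
    · have h := h.1
      norm_cast at h
    · have h := h.1
      norm_cast at h
    · cases p <;> cases q <;> simp at h ⊢ <;> norm_num at h
  · rintro (i | p)
    · exact ⟨.inr false, .inr true, by simp, trivial, trivial⟩
    · exact ⟨.inl ⟨0, by omega⟩, .inl ⟨1, hn⟩, by simp, trivial, trivial⟩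
  · intro u v u' v' h h' hne
    -- Every edge has a pole as an end, so both edges may be oriented towards a pole.
    wlog hv : ∃ q, v = .inr q generalizing u v
    · rcases v with j | q
      · rcases u with i | p
        · exact h.elim
        · rw [openSegment_symm]
          exact this (.inl j) (.inr p) trivial (fun e => hne (Sym2.eq_swap.trans e)) ⟨p, rfl⟩
      · exact absurd ⟨q, rfl⟩ hv
    wlog hv' : ∃ q, v' = .inr q generalizing u' v'
    · rcases v' with j | q
      · rcases u' with i | p
        · exact h'.elim
        · rw [segment_symm]
          exact this (.inl j) (.inr p) trivial (fun e => hne (e.trans Sym2.eq_swap)) ⟨p, rfl⟩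
      · exact absurd ⟨q, rfl⟩ hv'
    obtain ⟨q, rfl⟩ := hv
    obtain ⟨q', rfl⟩ := hv'
    refine Separated.disjoint ?_
    rcases u with i | p <;> rcases u' with j | p'
    · by_cases hij : i = j
      · subst hij
        have hqq : q ≠ q' := fun e => hne (e ▸ rfl)
        cases q <;> cases q' <;> simp [Separated, area, bookPosition] at hqq ⊢ <;> omega
      · have := cast_ne i j hij
        cases q <;> cases q' <;> simp [Separated, area, bookPosition] <;> omega
    · have hpq : p' ≠ q' := h'
      cases q <;> cases q' <;> cases p' <;> simp [Separated, area, bookPosition] at hpq ⊢ <;> omega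
    · have hpq : p ≠ q := h
      cases q <;> cases q' <;> cases p <;> simp [Separated, area, bookPosition] at hpq ⊢ <;> omega
    · have hpq : p ≠ q := h
      have hpq' : p' ≠ q' := h'
      cases q <;> cases q' <;> cases p <;> cases p' <;> simp at hpq hpq' hne

/-! #### Necklaces -/

/-- A straight-line drawing of a bead with the pole `false`, which is the last vertex. -/
def beadPosition : Fin 8 → ℤ × ℤ :=
  ![(3, -1), (6, -5), (6, 5), (3, 1), (2, 0), (5, 1), (7, 5), (0, 0)]

/-- The edges of a bead with the pole `false`, which is the last vertex. -/
def poledBeadEdges : List (Fin 8 × Fin 8) :=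
  [(0, 1), (1, 2), (2, 3), (3, 4), (4, 0), (0, 5), (1, 5), (2, 5), (3, 5), (4, 5), (2, 6),
    (7, 0), (7, 1), (7, 2), (7, 3), (7, 4)]

set_option maxRecDepth 8000 in
theorem separated_of_mem_poledBeadEdges : ∀ e ∈ poledBeadEdges, ∀ f ∈ poledBeadEdges, e ≠ f →
    Separated (beadPosition e.1) (beadPosition e.2) (beadPosition f.1) (beadPosition f.2) := by
  decide

/-- A shear with vertical fibres. -/
def shear (k : ℤ) (p : ℤ × ℤ) : ℤ × ℤ := (p.1, p.2 + 2 * k * p.1)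

theorem area_shear (k : ℤ) (p q r : ℤ × ℤ) :
    area (shear k p) (shear k q) (shear k r) = area p q r := by
  simp only [area, shear]; ring

theorem separated_shear {k : ℤ} {p q r s : ℤ × ℤ} :
    Separated (shear k p) (shear k q) (shear k r) (shear k s) ↔ Separated p q r s := by
  simp only [Separated, area_shear]

/-- A straight-line drawing of a necklace. -/
def necklacePosition {m : ℕ} : NecklaceVertex m → ℤ × ℤ
  | .inl (i, x) => shear i (beadPosition x.castSucc)
  | .inr p => (if p then 8 else 0, 0)

/-- The vertices of a bead with the pole `false`, as vertices of the necklace. -/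
def poledBeadVertex {m : ℕ} (i : Fin m) (x : Fin 8) : NecklaceVertex m :=
  if h : x.1 < 7 then .inl (i, ⟨x.1, h⟩) else .inr false

theorem necklacePosition_poledBeadVertex {m : ℕ} (i : Fin m) (x : Fin 8) :
    necklacePosition (poledBeadVertex i x) = shear i (beadPosition x) := by
  unfold poledBeadVertex
  split_ifs with h
  · rfl
  · obtain rfl : x = 7 := by omega
    simp [necklacePosition, shear, beadPosition]

/-- The edges of the necklace, each in one of its two orientations. -/
inductive NecklaceArc {m : ℕ} : NecklaceVertex m → NecklaceVertex m → Prop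
  | bead (i : Fin m) (e : Fin 8 × Fin 8) (he : e ∈ poledBeadEdges) :
      NecklaceArc (poledBeadVertex i e.1) (poledBeadVertex i e.2)
  | pole (i : Fin m) : NecklaceArc (.inl (i, 6)) (.inr true)

theorem necklaceArc_of_adj {m : ℕ} {u v : NecklaceVertex m} (h : (necklace m).Adj u v) :
    NecklaceArc u v ∨ NecklaceArc v u := by
  have h1 : ∀ x y, (x, y) ∈ beadEdges → (x.castSucc, y.castSucc) ∈ poledBeadEdges := by decide
  have h2 : ∀ x, PoleAdj false x → ((7 : Fin 8), x.castSucc) ∈ poledBeadEdges := by decide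
  have h3 : ∀ x, PoleAdj true x → x = 6 := by decide
  have bead : ∀ i x y, (x, y) ∈ beadEdges →
      NecklaceArc (.inl (i, x) : NecklaceVertex m) (.inl (i, y)) := by
    intro i x y h
    have := NecklaceArc.bead i _ (h1 x y h)
    simpa [poledBeadVertex] using this
  have pole : ∀ i x p, PoleAdj p x →
      NecklaceArc (.inl (i, x) : NecklaceVertex m) (.inr p) ∨
        NecklaceArc (.inr p : NecklaceVertex m) (.inl (i, x)) := by
    intro i x p h
    cases p
    · have := NecklaceArc.bead i _ (h2 x h)
      exact Or.inr (by simpa [poledBeadVertex] using this)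
    · obtain rfl := h3 x h
      exact Or.inl (.pole i)
  rcases u with ⟨i, x⟩ | p <;> rcases v with ⟨j, y⟩ | q
  · obtain ⟨rfl, h | h⟩ := h
    · exact Or.inl (bead i x y h)
    · exact Or.inr (bead i y x h)
  · exact pole i x q h
  · exact (pole j y p h).symm
  · exact h.elim

/-- The interior of an edge of a bead lies in the open cone that belongs to the bead. -/
theorem mem_cone_of_mem_openSegment {k : ℤ} {e : Fin 8 × Fin 8} (he : e ∈ poledBeadEdges)
    {z : ℝ × ℝ} (hz : z ∈ openSegment ℝ (realPoint (shear k (beadPosition e.1)))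
      (realPoint (shear k (beadPosition e.2)))) :
    z.2 - 2 * k * z.1 < z.1 ∧ -z.1 < z.2 - 2 * k * z.1 ∧ z.1 < 7 := by
  -- The apex of the cone is the pole, which is only ever listed as the first end of an edge. So the
  -- second end is strictly inside, and no edge has both ends on the line `x = 7`.
  have key : ∀ e ∈ poledBeadEdges,
      let p := beadPosition e.1
      let q := beadPosition e.2
      p.2 ≤ p.1 ∧ -p.1 ≤ p.2 ∧ p.1 ≤ 7 ∧ q.2 < q.1 ∧ -q.1 < q.2 ∧ q.1 ≤ 7 ∧
        (p.1 < 7 ∨ q.1 < 7) := by decide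
  obtain ⟨a, b, ha, hb, hab, rfl⟩ := hz
  obtain ⟨h1, h2, h3, h4, h5, h6, h7⟩ := key e he
  simp only [realPoint, shear, Prod.smul_mk, Prod.mk_add_mk, smul_eq_mul]
  rify at h1 h2 h3 h4 h5 h6 h7
  push_cast
  obtain rfl : a = 1 - b := by linarith
  refine ⟨?_, ?_, ?_⟩
  · nlinarith [mul_le_mul_of_nonneg_left h1 ha.le, mul_lt_mul_of_pos_left h4 hb]
  · nlinarith [mul_le_mul_of_nonneg_left h2 ha.le, mul_lt_mul_of_pos_left h5 hb]
  · rcases h7 with h7 | h7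
    · nlinarith [mul_lt_mul_of_pos_left h7 ha, mul_le_mul_of_nonneg_left h6 hb.le]
    · nlinarith [mul_lt_mul_of_pos_left h7 hb, mul_le_mul_of_nonneg_left h3 ha.le]

theorem mem_cone_of_mem_segment {k : ℤ} {e : Fin 8 × Fin 8} (he : e ∈ poledBeadEdges)
    {z : ℝ × ℝ} (hz : z ∈ segment ℝ (realPoint (shear k (beadPosition e.1)))
      (realPoint (shear k (beadPosition e.2)))) :
    z.2 - 2 * k * z.1 ≤ z.1 ∧ -z.1 ≤ z.2 - 2 * k * z.1 ∧ z.1 ≤ 7 := by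
  have key : ∀ e ∈ poledBeadEdges,
      let p := beadPosition e.1
      let q := beadPosition e.2
      p.2 ≤ p.1 ∧ -p.1 ≤ p.2 ∧ p.1 ≤ 7 ∧ q.2 ≤ q.1 ∧ -q.1 ≤ q.2 ∧ q.1 ≤ 7 := by decide
  obtain ⟨a, b, ha, hb, hab, rfl⟩ := hz
  obtain ⟨h1, h2, h3, h4, h5, h6⟩ := key e he
  simp only [realPoint, shear, Prod.smul_mk, Prod.mk_add_mk, smul_eq_mul]
  rify at h1 h2 h3 h4 h5 h6
  push_cast
  obtain rfl : a = 1 - b := by linarith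
  refine ⟨?_, ?_, ?_⟩
  · nlinarith [mul_le_mul_of_nonneg_left h1 ha, mul_le_mul_of_nonneg_left h4 hb]
  · nlinarith [mul_le_mul_of_nonneg_left h2 ha, mul_le_mul_of_nonneg_left h5 hb]
  · nlinarith [mul_le_mul_of_nonneg_left h3 ha, mul_le_mul_of_nonneg_left h6 hb]

theorem disjoint_segments_of_necklaceArc {m : ℕ} {u v u' v' : NecklaceVertex m}
    (h : NecklaceArc u v) (h' : NecklaceArc u' v') (hne : s(u, v) ≠ s(u', v')) :
    Disjoint (openSegment ℝ (realPoint (necklacePosition u)) (realPoint (necklacePosition v)))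
      (segment ℝ (realPoint (necklacePosition u')) (realPoint (necklacePosition v'))) := by
  have cast_ne : ∀ i j : Fin m, i ≠ j → (i : ℤ) < j ∨ (j : ℤ) < i := fun i j h => by
    have : (i : ℕ) ≠ j := fun e => h (Fin.ext e)
    omega
  cases h with
  | bead i e he =>
    cases h' with
    | bead j f hf =>
      simp only [necklacePosition_poledBeadVertex]
      by_cases hij : i = j
      · subst hij
        refine (separated_shear.2 (separated_of_mem_poledBeadEdges e he f hf ?_)).disjoint
        rintro rfl
        exact hne rfl
      · rw [Set.disjoint_left]
        intro z hz hz'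
        obtain ⟨h1, h2, h3⟩ := mem_cone_of_mem_openSegment he hz
        obtain ⟨h4, h5, h6⟩ := mem_cone_of_mem_segment hf hz'
        -- For positive abscissa, the slopes in the cone of bead `i` are strictly between `2 * i -
        -- 1` and `2 * i + 1`, and those in the closed cone of bead `j` are at most 1 away from `2 *
        -- j`.
        have hpos : 0 < z.1 := by linarith
        rcases cast_ne i j hij with h | h
        · have h : ((i : ℤ) : ℝ) + 1 ≤ ((j : ℤ) : ℝ) := by exact_mod_cast h
          nlinarith
        · have h : ((j : ℤ) : ℝ) + 1 ≤ ((i : ℤ) : ℝ) := by exact_mod_cast h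
          nlinarith
    | pole j =>
      simp only [necklacePosition_poledBeadVertex]
      rw [Set.disjoint_left]
      intro z hz hz'
      obtain ⟨h1, h2, h3⟩ := mem_cone_of_mem_openSegment he hz
      obtain ⟨a, b, ha, hb, hab, rfl⟩ := hz'
      simp [realPoint, necklacePosition, shear, beadPosition] at h3
      -- Bead edges have abscissa below 7 in their interior, edges to the pole `true` at least 7.
      linarith
  | pole i =>
    cases h' with
    | bead j f hf =>
      simp only [necklacePosition_poledBeadVertex]
      rw [Set.disjoint_left]
      intro z hz hz'
      obtain ⟨h1, h2, h3⟩ := mem_cone_of_mem_segment hf hz'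
      obtain ⟨a, b, ha, hb, hab, rfl⟩ := hz
      simp [realPoint, necklacePosition, shear, beadPosition] at h3
      linarith
    | pole j =>
      refine Separated.disjoint ?_
      have hij : i ≠ j := by
        rintro rfl
        exact hne rfl
      have := cast_ne i j hij
      simp [Separated, area, necklacePosition, shear, beadPosition]
      omega

theorem realPoint_injective : Function.Injective realPoint := by
  rintro ⟨a, b⟩ ⟨c, d⟩ h
  simpa [realPoint] using h

theorem necklacePosition_injective {m : ℕ} :
    Function.Injective (necklacePosition : NecklaceVertex m → ℤ × ℤ) := by
  -- Shears move a point vertically by multiples of twice its abscissa, so it suffices that bead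
  -- vertices in the same column are incongruent modulo that number.
  have key : ∀ x y : Fin 7, (beadPosition x.castSucc).1 = (beadPosition y.castSucc).1 →
      x = y ∨ ¬ (2 * (beadPosition x.castSucc).1 ∣
        (beadPosition x.castSucc).2 - (beadPosition y.castSucc).2) := by decide
  have hpos : ∀ x : Fin 7, 0 < (beadPosition x.castSucc).1 ∧ (beadPosition x.castSucc).1 < 8 := by
    decide
  rintro (⟨i, x⟩ | p) (⟨j, y⟩ | q) h <;>
    simp only [necklacePosition, shear, Prod.mk.injEq] at h <;> obtain ⟨h1, h2⟩ := h
  · rcases key x y h1 with rfl | hd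
    · have : (i : ℤ) = j := by
        have := (hpos x).1
        have h3 : 2 * (beadPosition x.castSucc).1 * (i : ℤ) =
          2 * (beadPosition x.castSucc).1 * (j : ℤ) := by linarith
        exact mul_left_cancel₀ (by omega) h3
      obtain rfl : i = j := Fin.ext (by exact_mod_cast this)
      rfl
    · refine absurd ⟨(j : ℤ) - i, ?_⟩ hd
      rw [← h1] at h2
      linarith
  · have := hpos x
    split_ifs at h1 <;> omega
  · have := hpos y
    split_ifs at h1 <;> omega
  · cases p <;> cases q <;> simp at h1 ⊢

theorem isPlanar_necklace {m : ℕ} (hm : 1 < m) : IsPlanar (necklace m) := by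
  refine isPlanar_of_disjoint_segments (fun v => realPoint (necklacePosition v)) ?_ ?_ ?_
  · exact realPoint_injective.comp necklacePosition_injective
  · have key : ∀ x, ∃ y z, y ≠ z ∧ BeadAdj x y ∧ BeadAdj x z ∨ x = 6 := by decide
    rintro (⟨i, x⟩ | p)
    · by_cases hx : x = 6
      · subst hx
        exact ⟨.inl (i, 2), .inr true, by simp, ⟨rfl, by decide⟩, (by decide : PoleAdj true 6)⟩
      · obtain ⟨y, z, h⟩ := key x
        obtain ⟨hyz, hy, hz⟩ := h.resolve_right hx
        exact ⟨.inl (i, y), .inl (i, z), by simpa using hyz, ⟨rfl, hy⟩, ⟨rfl, hz⟩⟩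
    · have key : ∀ p, ∃ x, PoleAdj p x := by decide
      obtain ⟨x, hx⟩ := key p
      exact ⟨.inl (⟨0, by omega⟩, x), .inl (⟨1, hm⟩, x), by simp, hx, hx⟩
  · intro u v u' v' h h' hne
    rcases necklaceArc_of_adj h with h | h <;> rcases necklaceArc_of_adj h' with h' | h'
    · exact disjoint_segments_of_necklaceArc h h' hne
    · rw [segment_symm]
      exact disjoint_segments_of_necklaceArc h h' (by rwa [Sym2.eq_swap (a := v')])
    · rw [openSegment_symm]
      exact disjoint_segments_of_necklaceArc h h' (by rwa [Sym2.eq_swap (a := v)])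
    · rw [openSegment_symm, segment_symm]
      exact disjoint_segments_of_necklaceArc h h'
        (by rwa [Sym2.eq_swap (a := v), Sym2.eq_swap (a := v')])


/-! ### Constructing representations -/

theorem grid_adj {p q : ℤ × ℤ} : grid.Adj p q ↔
    (p.2 = q.2 ∧ (q.1 = p.1 + 1 ∨ p.1 = q.1 + 1)) ∨
      (p.1 = q.1 ∧ (q.2 = p.2 + 1 ∨ p.2 = q.2 + 1)) := Iff.rfl

namespace GridPath

theorem exists_of_fun (γ : ℕ → ℤ × ℤ) (n : ℕ) (hn : 0 < n)
    (hadj : ∀ i < n, grid.Adj (γ i) (γ (i + 1)))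
    (hinj : ∀ i ≤ n, ∀ j ≤ n, γ i = γ j → i = j) :
    ∃ P : GridPath, P.start = γ 0 ∧ P.finish = γ n ∧ P.walk.length = n ∧
      ∀ i ≤ n, P.walk.getVert i = γ i := by
  have key : ∀ k ≤ n, ∃ w : grid.Walk (γ 0) (γ k), w.length = k ∧ ∀ i ≤ k, w.getVert i = γ i := by
    intro k hk
    induction k with
    | zero => exact ⟨.nil, rfl, fun i hi => by rw [Nat.le_zero.1 hi, Walk.getVert_zero]⟩
    | succ k ih =>
      obtain ⟨w, hw, hwi⟩ := ih (by omega)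
      refine ⟨w.concat (hadj k (by omega)), by simp [hw], fun i hi => ?_⟩
      rw [Walk.concat_eq_append, Walk.getVert_append, hw]
      split_ifs with h
      · exact hwi i h.le
      · obtain h | rfl : i = k ∨ i = k + 1 := by omega
        · simp [h]
        · simp
  obtain ⟨w, hw, hwi⟩ := key n le_rfl
  refine ⟨⟨γ 0, γ n, w, ?_, fun h => hn.ne (hinj 0 (Nat.zero_le _) n le_rfl h)⟩, rfl, rfl, hw, hwi⟩
  rw [← Walk.IsPath.getVert_injOn_iff]
  intro i hi j hj hij
  rw [Set.mem_ofPred_eq, hw] at hi hj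
  rw [hwi i hi, hwi j hj] at hij
  exact hinj i hi j hj hij

/-- The path through given points. -/
noncomputable def ofFun (γ : ℕ → ℤ × ℤ) (n : ℕ) (hn : 0 < n)
    (hadj : ∀ i < n, grid.Adj (γ i) (γ (i + 1)))
    (hinj : ∀ i ≤ n, ∀ j ≤ n, γ i = γ j → i = j) : GridPath :=
  Classical.choose (exists_of_fun γ n hn hadj hinj)

section

variable {γ : ℕ → ℤ × ℤ} {n : ℕ} {hn : 0 < n} {hadj : ∀ i < n, grid.Adj (γ i) (γ (i + 1))}
  {hinj : ∀ i ≤ n, ∀ j ≤ n, γ i = γ j → i = j}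

theorem start_ofFun : (ofFun γ n hn hadj hinj).start = γ 0 :=
  (Classical.choose_spec (exists_of_fun γ n hn hadj hinj)).1

theorem finish_ofFun : (ofFun γ n hn hadj hinj).finish = γ n :=
  (Classical.choose_spec (exists_of_fun γ n hn hadj hinj)).2.1

theorem length_ofFun : (ofFun γ n hn hadj hinj).walk.length = n :=
  (Classical.choose_spec (exists_of_fun γ n hn hadj hinj)).2.2.1

theorem getVert_ofFun {i : ℕ} (hi : i ≤ n) : (ofFun γ n hn hadj hinj).walk.getVert i = γ i :=
  (Classical.choose_spec (exists_of_fun γ n hn hadj hinj)).2.2.2 i hi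

theorem mem_points_ofFun {z : ℤ × ℤ} :
    z ∈ (ofFun γ n hn hadj hinj).points ↔ ∃ i ≤ n, γ i = z := by
  refine Walk.mem_support_iff_exists_getVert.trans ?_
  rw [length_ofFun]
  exact ⟨fun ⟨i, h, hi⟩ => ⟨i, hi, by rwa [getVert_ofFun hi] at h⟩,
    fun ⟨i, hi, h⟩ => ⟨i, by rwa [getVert_ofFun hi], hi⟩⟩

theorem bends_ofFun_le {s : Finset ℕ}
    (hs : ∀ i, 0 < i → i < n → γ (i + 1) - γ i ≠ γ i - γ (i - 1) → i ∈ s) :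
    (ofFun γ n hn hadj hinj).bends ≤ s.card := by
  refine Finset.card_le_card fun i hi => ?_
  rw [Finset.mem_filter, Finset.mem_Ioo, length_ofFun] at hi
  obtain ⟨⟨h0, h1⟩, h⟩ := hi
  rw [getVert_ofFun (by omega), getVert_ofFun (by omega), getVert_ofFun (by omega)] at h
  exact hs i h0 h1 h

end

/-- Two paths meet in a single point, which is an endpoint of one of them. -/
def MeetAtEnd (P Q : GridPath) : Prop :=
  ∃ z, z ∈ P.points ∧ z ∈ Q.points ∧ (P.IsEnd z ∨ Q.IsEnd z) ∧
    ∀ x, x ∈ P.points → x ∈ Q.points → x = z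

theorem MeetAtEnd.symm {P Q : GridPath} (h : P.MeetAtEnd Q) : Q.MeetAtEnd P := by
  obtain ⟨z, hP, hQ, h, hz⟩ := h
  exact ⟨z, hQ, hP, h.symm, fun x h h' => hz x h' h⟩

theorem MeetAtEnd.interiorlyDisjoint {P Q : GridPath} (h : P.MeetAtEnd Q) :
    P.InteriorlyDisjoint Q := by
  obtain ⟨z, hP, hQ, h, hz⟩ := h
  constructor
  · rw [Set.disjoint_left]
    rintro x ⟨hx, hx'⟩ ⟨hy, hy'⟩
    rw [hz x hx hy] at hx' hy'
    exact h.elim (fun h => h.elim hx'.1 hx'.2) fun h => h.elim hy'.1 hy'.2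
  · rw [Set.disjoint_left]
    intro e he he'
    induction e with
    | _ x y =>
      have hx := hz x (P.walk.fst_mem_support_of_mem_edges he)
        (Q.walk.fst_mem_support_of_mem_edges he')
      have hy := hz y (P.walk.snd_mem_support_of_mem_edges he)
        (Q.walk.snd_mem_support_of_mem_edges he')
      exact (P.walk.adj_of_mem_edges he).ne (hx.trans hy.symm)

theorem interiorlyDisjoint_of_disjoint {P Q : GridPath} (h : Disjoint P.points Q.points) :
    P.InteriorlyDisjoint Q := by
  rw [Set.disjoint_left] at h
  constructor
  · exact Set.disjoint_left.2 fun x hx hx' => h hx.1 hx'.1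
  · rw [Set.disjoint_left]
    intro e he he'
    induction e with
    | _ x y =>
      exact h (P.walk.fst_mem_support_of_mem_edges he) (Q.walk.fst_mem_support_of_mem_edges he')

end GridPath

/-- A family of paths that meet at most once, and at an endpoint of one of them, is a CPG
representation. -/
def Representation.ofMeetAtEnd {V : Type*} {G : SimpleGraph V} (path : V → GridPath)
    (h : ∀ u v, u ≠ v → (G.Adj u v ∧ (path u).MeetAtEnd (path v)) ∨
      (¬ G.Adj u v ∧ Disjoint (path u).points (path v).points)) : Representation G where
  path := path
  interiorlyDisjoint u v huv := (h u v huv).elim (fun h => h.2.interiorlyDisjoint)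
    fun h => GridPath.interiorlyDisjoint_of_disjoint h.2
  adj_iff u v huv := by
    rcases h u v huv with ⟨h, z, h1, h2, -⟩ | ⟨h, h'⟩
    · exact ⟨fun _ => ⟨z, h1, h2⟩, fun _ => h⟩
    · exact ⟨fun h'' => absurd h'' h, fun ⟨z, h1, h2⟩ => absurd h2 (Set.disjoint_left.1 h' h1)⟩

theorem IsBendCPG.comap {V W : Type*} {G : SimpleGraph V} {k : ℕ} (h : IsBendCPG k G) (f : W ↪ V) :
    IsBendCPG k (G.comap f) := by
  obtain ⟨R, hR⟩ := h
  exact ⟨⟨fun v => R.path (f v), fun u v huv => R.interiorlyDisjoint _ _ (f.injective.ne huv),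
    fun u v huv => R.adj_iff _ _ (f.injective.ne huv)⟩, fun v => hR (f v)⟩

theorem IsBendCPG.mono {V : Type*} {G : SimpleGraph V} {k l : ℕ} (hkl : k ≤ l)
    (h : IsBendCPG k G) : IsBendCPG l G :=
  h.imp fun _ hR v => (hR v).trans hkl

/-! #### Books -/

/-- The paths of a book: a horizontal and a vertical segment with a common endpoint, and nested
paths with one bend between them. -/
noncomputable def bookPath (n : ℕ) : Fin n ⊕ Bool → GridPath
  | .inl i => .ofFun (fun k => (min (i + 1) (2 * (i + 1) - k), min (i + 1) k)) (2 * (i + 1))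
      (by omega) (fun k hk => by rw [grid_adj]; omega)
      (fun k hk l hl h => by simp only [Prod.mk.injEq] at h; omega)
  | .inr true => .ofFun (fun k => (0, k)) (n + 1) (by omega)
      (fun k hk => by simp [grid_adj])
      (fun k hk l hl h => by simp only [Prod.mk.injEq] at h; omega)
  | .inr false => .ofFun (fun k => (k, 0)) (n + 1) (by omega)
      (fun k hk => by simp [grid_adj])
      (fun k hk l hl h => by simp only [Prod.mk.injEq] at h; omega)

theorem isBendCPG_one_book (n : ℕ) : IsBendCPG 1 (book n) := by
  have meet : ∀ i p, (bookPath n (.inl i)).MeetAtEnd (bookPath n (.inr p)) := by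
    rintro i (_ | _)
    · refine ⟨(i + 1, 0), ?_, ?_, Or.inl (Or.inl ?_), ?_⟩ <;> unfold bookPath
      · exact GridPath.mem_points_ofFun.2 ⟨0, by omega, by ext <;> simp; omega⟩
      · exact GridPath.mem_points_ofFun.2 ⟨i + 1, by omega, by simp⟩
      · rw [GridPath.start_ofFun]; ext <;> simp; omega
      · simp only [GridPath.mem_points_ofFun]
        rintro ⟨x, y⟩ ⟨k, hk, h⟩ ⟨l, hl, h'⟩
        simp only [Prod.mk.injEq] at h h' ⊢
        omega
    · refine ⟨(0, i + 1), ?_, ?_, Or.inl (Or.inr ?_), ?_⟩ <;> unfold bookPath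
      · exact GridPath.mem_points_ofFun.2 ⟨2 * (i + 1), by omega, by ext <;> simp; omega⟩
      · exact GridPath.mem_points_ofFun.2 ⟨i + 1, by omega, by simp⟩
      · rw [GridPath.finish_ofFun]; ext <;> simp; omega
      · simp only [GridPath.mem_points_ofFun]
        rintro ⟨x, y⟩ ⟨k, hk, h⟩ ⟨l, hl, h'⟩
        simp only [Prod.mk.injEq] at h h' ⊢
        omega
  have poles : (bookPath n (.inr false)).MeetAtEnd (bookPath n (.inr true)) := by
    refine ⟨(0, 0), ?_, ?_, Or.inl (Or.inl ?_), ?_⟩ <;> unfold bookPath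
    · exact GridPath.mem_points_ofFun.2 ⟨0, by omega, by simp⟩
    · exact GridPath.mem_points_ofFun.2 ⟨0, by omega, by simp⟩
    · rw [GridPath.start_ofFun]; simp
    · simp only [GridPath.mem_points_ofFun]
      rintro ⟨x, y⟩ ⟨k, hk, h⟩ ⟨l, hl, h'⟩
      simp only [Prod.mk.injEq] at h h' ⊢
      omega
  refine ⟨.ofMeetAtEnd (bookPath n) ?_, ?_⟩
  · rintro (i | p) (j | q) huv
    · refine Or.inr ⟨fun h => h, Set.disjoint_left.2 ?_⟩
      have hij : (i : ℕ) ≠ j := fun h => huv (congrArg _ (Fin.ext h))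
      unfold bookPath
      simp only [GridPath.mem_points_ofFun]
      rintro ⟨x, y⟩ ⟨k, hk, h⟩ ⟨l, hl, h'⟩
      simp only [Prod.mk.injEq] at h h'
      omega
    · exact Or.inl ⟨trivial, meet i q⟩
    · exact Or.inl ⟨trivial, (meet j p).symm⟩
    · refine Or.inl ⟨fun h => huv (congrArg _ h), ?_⟩
      cases p <;> cases q
      · exact absurd rfl huv
      · exact poles
      · exact poles.symm
      · exact absurd rfl huv
  · rintro (i | _ | _) <;> change (bookPath n _).bends ≤ 1 <;> unfold bookPath
    · refine (GridPath.bends_ofFun_le (s := {i.1 + 1}) fun k h0 h1 h => ?_).trans (by simp)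
      by_contra hk
      refine h ?_
      simp only [Finset.mem_singleton] at hk
      ext <;> simp <;> omega
    · refine (GridPath.bends_ofFun_le (s := ∅) fun k h0 h1 h => absurd ?_ h).trans (by simp)
      ext <;> simp; omega
    · refine (GridPath.bends_ofFun_le (s := ∅) fun k h0 h1 h => absurd ?_ h).trans (by simp)
      ext <;> simp; omega


/-! #### Necklaces -/

/-- The place of the `j`-th bead: an isometry of the grid. -/
def place (j : ℕ) (p : ℤ × ℤ) : ℤ × ℤ :=
  if j = 0 then (-8 - p.1, p.2)
  else if j % 2 = 1 then (8 * (j / 2 : ℕ) + p.1, -8 * (j / 2 : ℕ) + p.2)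
  else (8 * (j / 2 : ℕ) - 8 - p.2, -8 * (j / 2 : ℕ) - p.1)

theorem place_injective (j : ℕ) : Function.Injective (place j) := by
  intro p q h
  simp only [place] at h
  rw [Prod.ext_iff] at h ⊢
  split_ifs at h <;> simp only at h <;> omega

theorem grid_adj_place {j : ℕ} {p q : ℤ × ℤ} (h : grid.Adj p q) :
    grid.Adj (place j p) (place j q) := by
  rw [grid_adj] at h ⊢
  simp only [place]
  split_ifs <;> simp only <;> omega

theorem place_sub_eq {j : ℕ} {p q r : ℤ × ℤ} (h : p - q = q - r) :
    place j p - place j q = place j q - place j r := by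
  simp only [Prod.ext_iff, Prod.fst_sub, Prod.snd_sub] at h ⊢
  simp only [place]
  split_ifs <;> simp only <;> omega

/-- The points of the paths of a bead, without the path of the pendant vertex. -/
def beadPoints : Fin 7 → List (ℤ × ℤ) :=
  ![[(0, 0), (0, 1), (-1, 1)],
    [(0, 0), (1, 0), (1, 1), (1, 2), (0, 2)],
    [(-3, 0), (-3, 1), (-3, 2), (-3, 3), (-2, 3), (-1, 3), (0, 3), (0, 2)],
    [(-2, 0), (-2, 1), (-3, 1)],
    [(-1, 0), (-1, 1), (-2, 1)],
    [(0, 1), (0, 2), (-1, 2), (-2, 2), (-2, 1)],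
    []]

/-- The length of the path of the pendant vertex of the `j`-th bead. -/
def stringLength (j : ℕ) : ℕ := if j = 0 then 2 else if j % 2 = 1 then 8 * (j / 2) + 2 else 4 * j

theorem beadPoints_length_pos : ∀ x ≠ (6 : Fin 7), 0 < (beadPoints x).length - 1 := by decide

theorem grid_adj_beadPoints : ∀ x : Fin 7, ∀ i < (beadPoints x).length - 1,
    (((beadPoints x).getD i 0).2 = ((beadPoints x).getD (i + 1) 0).2 ∧
      (((beadPoints x).getD (i + 1) 0).1 = ((beadPoints x).getD i 0).1 + 1 ∨
        ((beadPoints x).getD i 0).1 = ((beadPoints x).getD (i + 1) 0).1 + 1)) ∨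
    (((beadPoints x).getD i 0).1 = ((beadPoints x).getD (i + 1) 0).1 ∧
      (((beadPoints x).getD (i + 1) 0).2 = ((beadPoints x).getD i 0).2 + 1 ∨
        ((beadPoints x).getD i 0).2 = ((beadPoints x).getD (i + 1) 0).2 + 1)) := by decide

theorem beadPoints_nodup : ∀ x, (beadPoints x).Nodup := by decide

theorem card_bends_beadPoints_le : ∀ x, ((Finset.Ioo 0 ((beadPoints x).length - 1)).filter fun i =>
    (beadPoints x).getD (i + 1) 0 - (beadPoints x).getD i 0 ≠
      (beadPoints x).getD i 0 - (beadPoints x).getD (i - 1) 0).card ≤ 2 := by decide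

/-- The paths of a bead. -/
noncomputable def beadPath (j : ℕ) (x : Fin 7) : GridPath :=
  if hx : x = 6 then
    .ofFun (fun k => place j (0, 3 + k)) (stringLength j)
      (by unfold stringLength; split_ifs <;> omega)
      (fun k hk => grid_adj_place (by simp [grid_adj, add_assoc]))
      (fun k hk l hl h => by have := place_injective j h; simp only [Prod.mk.injEq] at this; omega)
  else
    .ofFun (fun k => place j ((beadPoints x).getD k 0)) ((beadPoints x).length - 1)
      (beadPoints_length_pos x hx) (fun k hk => grid_adj_place (grid_adj_beadPoints x k hk))
      (fun k hk l hl h => by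
        have hpos := beadPoints_length_pos x hx
        have := place_injective j h
        rw [List.getD_eq_getElem _ _ (by omega), List.getD_eq_getElem _ _ (by omega)] at this
        exact (beadPoints_nodup x).getElem_inj_iff.1 this)

/-- The points of the paths of a bead, before the bead is placed. -/
def beadRegion (j : ℕ) (x : Fin 7) : Set (ℤ × ℤ) :=
  if x = 6 then {p | p.1 = 0 ∧ 3 ≤ p.2 ∧ p.2 ≤ 3 + stringLength j} else {p | p ∈ beadPoints x}

theorem mem_points_beadPath {j : ℕ} {x : Fin 7} {z : ℤ × ℤ} :
    z ∈ (beadPath j x).points ↔ ∃ p ∈ beadRegion j x, place j p = z := by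
  unfold beadPath beadRegion
  split_ifs with hx
  · rw [GridPath.mem_points_ofFun]
    constructor
    · rintro ⟨k, hk, rfl⟩
      exact ⟨(0, 3 + k), ⟨rfl, by simp, by simpa using hk⟩, rfl⟩
    · rintro ⟨⟨a, b⟩, ⟨h1, h2, h3⟩, rfl⟩
      simp only at h1 h2 h3
      exact ⟨(b - 3).toNat, by omega, by
        congr 1; simp only [Prod.mk.injEq]; omega⟩
  · have hpos := beadPoints_length_pos x hx
    rw [GridPath.mem_points_ofFun]
    constructor
    · rintro ⟨k, hk, rfl⟩
      rw [List.getD_eq_getElem _ _ (by omega)]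
      exact ⟨_, List.getElem_mem _, rfl⟩
    · rintro ⟨p, hp, rfl⟩
      obtain ⟨k, hk, rfl⟩ := List.getElem_of_mem hp
      exact ⟨k, by omega, by rw [List.getD_eq_getElem _ _ hk]⟩

theorem isEnd_beadPath {j : ℕ} {x : Fin 7} (hx : x ≠ 6) {p : ℤ × ℤ}
    (hp : p = (beadPoints x).getD 0 0 ∨ p = (beadPoints x).getD ((beadPoints x).length - 1) 0) :
    (beadPath j x).IsEnd (place j p) := by
  unfold beadPath
  rw [dif_neg hx, GridPath.IsEnd, GridPath.start_ofFun, GridPath.finish_ofFun]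
  exact hp.imp (congrArg _) (congrArg _)

theorem isEnd_beadPath_six {j : ℕ} {p : ℤ × ℤ}
    (hp : p = (0, 3) ∨ p = (0, 3 + (stringLength j : ℤ))) :
    (beadPath j 6).IsEnd (place j p) := by
  unfold beadPath
  rw [dif_pos rfl, GridPath.IsEnd, GridPath.start_ofFun, GridPath.finish_ofFun]
  exact hp.imp (fun h => by simp [h]) (fun h => by simp [h])

theorem bends_beadPath_le (j : ℕ) (x : Fin 7) : (beadPath j x).bends ≤ 2 := by
  unfold beadPath
  split_ifs with hx
  · refine (GridPath.bends_ofFun_le (s := ∅) fun k h0 h1 h => absurd ?_ h).trans (by simp)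
    refine place_sub_eq ?_
    ext <;> simp; omega
  · refine (GridPath.bends_ofFun_le fun k h0 h1 h => ?_).trans (card_bends_beadPoints_le x)
    exact Finset.mem_filter.2 ⟨Finset.mem_Ioo.2 ⟨h0, h1⟩, fun e => h (place_sub_eq e)⟩

/-- A set that contains all the points of a bead. -/
theorem beadRegion_subset {j : ℕ} {x : Fin 7} {p : ℤ × ℤ} (hp : p ∈ beadRegion j x) :
    ((-3 ≤ p.1 ∧ p.1 ≤ 1) ∧ 0 ≤ p.2 ∧ p.2 ≤ 3) ∨
      (p.1 = 0 ∧ 3 ≤ p.2 ∧ p.2 ≤ 3 + stringLength j) := by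
  unfold beadRegion at hp
  split_ifs at hp
  · exact Or.inr hp
  · have key : ∀ x : Fin 7, ∀ p ∈ beadPoints x, (-3 ≤ p.1 ∧ p.1 ≤ 1) ∧ 0 ≤ p.2 ∧ p.2 ≤ 3 := by
      decide
    exact Or.inl (key x p hp)

/-- Apart from bead `0` at the start, the odd beads sit at the upper right turns of the staircase
and send their strings up; the even ones sit at the lower left turns and send theirs to the left.
With steps of length 8 the boxes and strings stay apart. -/
theorem place_ne_place {i j : ℕ} (hij : i ≠ j) {x y : Fin 7} {p q : ℤ × ℤ}
    (hp : p ∈ beadRegion i x) (hq : q ∈ beadRegion j y) : place i p ≠ place j q := by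
  replace hp := beadRegion_subset hp
  replace hq := beadRegion_subset hq
  obtain ⟨a, b⟩ := p
  obtain ⟨c, d⟩ := q
  unfold stringLength at hp hq
  simp only [place, ne_eq]
  intro h
  rw [Prod.ext_iff] at h
  split_ifs at h hp hq <;> simp only at h hp hq <;> omega

/-- The points of the path of the pole `false`. -/
def stairs (n : ℕ) : ℤ × ℤ :=
  (8 * (n / 16 : ℕ) + min (n % 16 : ℕ) 8 - 8, -8 * (n / 16 : ℕ) - max ((n % 16 : ℕ) - 8) 0)

/-- Only the base of a bead can lie on the staircase, so contacts with the pole `false` reduce to a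
finite check in one unplaced bead. -/
theorem stairs_eq_place {n j : ℕ} {x : Fin 7} {p : ℤ × ℤ} (hp : p ∈ beadRegion j x)
    (h : stairs n = place j p) : p.2 = 0 ∧ p.1 ≤ 0 := by
  replace hp := beadRegion_subset hp
  obtain ⟨a, b⟩ := p
  unfold stringLength at hp
  simp only [place, stairs] at h
  rw [Prod.ext_iff] at h
  split_ifs at h hp <;> simp only at h hp ⊢ <;> omega

theorem exists_stairs_eq_place {m j : ℕ} (hj : j < m) (hm : 1 < m) {a : ℤ} (h : -3 ≤ a)
    (h' : a ≤ 0) : ∃ n ≤ 8 * (m - 1), stairs n = place j (a, 0) := by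
  -- Bead `j` has its origin at position `8 * j` and its base on the part of the stairs before it;
  -- bead `0` is reflected, so its base comes after.
  refine ⟨if j = 0 then (-a).toNat else (8 * j + a).toNat, ?_, ?_⟩
  · split_ifs <;> omega
  · simp only [place, stairs]
    rw [Prod.ext_iff]
    split_ifs <;> simp only <;> omega

/-- The points of the path of the pole `true`. -/
def frame (m n : ℕ) : ℤ × ℤ := (max (8 * m - n : ℤ) (-11), min 5 (8 * m + 16 - n : ℤ))

/-- The lengths of the strings are chosen so that they just reach the line `y = 5` or `x = -11` of
the frame. -/
theorem frame_eq_place {m n j : ℕ} {x : Fin 7} {p : ℤ × ℤ} (hp : p ∈ beadRegion j x)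
    (h : frame m n = place j p) : p = (0, 3 + (stringLength j : ℤ)) := by
  replace hp := beadRegion_subset hp
  obtain ⟨a, b⟩ := p
  unfold stringLength at hp ⊢
  simp only [place, frame] at h
  rw [Prod.ext_iff] at h ⊢
  split_ifs at h hp ⊢ <;> simp only at h hp ⊢ <;> omega

theorem exists_frame_eq_place {m j : ℕ} (hj : j < m) :
    ∃ n ≤ 16 * m + 16, frame m n = place j (0, 3 + (stringLength j : ℤ)) := by
  refine ⟨if j = 0 then 8 * m + 8 else if j % 2 = 1 then 8 * m - 8 * (j / 2) else
    8 * m + 16 + 8 * (j / 2), ?_, ?_⟩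
  · split_ifs <;> omega
  · simp only [place, frame, stringLength]
    rw [Prod.ext_iff]
    split_ifs <;> simp only <;> omega

theorem stairs_ne_frame (m n n' : ℕ) : stairs n ≠ frame m n' := by
  simp only [stairs, frame, ne_eq, Prod.mk.injEq]
  omega

/-- The paths of a necklace. -/
noncomputable def necklacePath {m : ℕ} (hm : 1 < m) : NecklaceVertex m → GridPath
  | .inl (i, x) => beadPath i x
  | .inr false => .ofFun stairs (8 * (m - 1)) (by omega)
      (fun k hk => by rw [grid_adj]; simp only [stairs]; omega)
      (fun k hk l hl h => by simp only [stairs, Prod.mk.injEq] at h; omega)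
  | .inr true => .ofFun (frame m) (16 * m + 16) (by omega)
      (fun k hk => by rw [grid_adj]; simp only [frame]; omega)
      (fun k hk l hl h => by simp only [frame, Prod.mk.injEq] at h; omega)

theorem mem_points_necklacePath_false {m : ℕ} (hm : 1 < m) {z : ℤ × ℤ} :
    z ∈ (necklacePath hm (.inr false)).points ↔ ∃ n ≤ 8 * (m - 1), stairs n = z := by
  unfold necklacePath
  exact GridPath.mem_points_ofFun

theorem mem_points_necklacePath_true {m : ℕ} (hm : 1 < m) {z : ℤ × ℤ} :
    z ∈ (necklacePath hm (.inr true)).points ↔ ∃ n ≤ 16 * m + 16, frame m n = z := by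
  unfold necklacePath
  exact GridPath.mem_points_ofFun

theorem meetAtEnd_beadPath {j : ℕ} {x y : Fin 7} (h : BeadAdj x y) :
    (beadPath j x).MeetAtEnd (beadPath j y) := by
  suffices key : ∃ p, p ∈ beadRegion j x ∧ p ∈ beadRegion j y ∧
      ((beadPath j x).IsEnd (place j p) ∨ (beadPath j y).IsEnd (place j p)) ∧
      ∀ q, q ∈ beadRegion j x → q ∈ beadRegion j y → q = p by
    obtain ⟨p, hx, hy, hend, hp⟩ := key
    refine ⟨place j p, mem_points_beadPath.2 ⟨p, hx, rfl⟩, mem_points_beadPath.2 ⟨p, hy, rfl⟩,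
      hend, fun z hz hz' => ?_⟩
    obtain ⟨q, hq, rfl⟩ := mem_points_beadPath.1 hz
    obtain ⟨r, hr, hqr⟩ := mem_points_beadPath.1 hz'
    obtain rfl := place_injective j hqr
    rw [hp r hq hr]
  have h62 : ∀ q, q ∈ beadRegion j 6 → q ∈ beadRegion j 2 → q = (0, 3) := by
    have key : ∀ p ∈ beadPoints 2, p.1 = 0 → 3 ≤ p.2 → p = (0, 3) := by decide
    exact fun q hq hq' => key q hq' hq.1 hq.2.1
  have m2 : ((0, 3) : ℤ × ℤ) ∈ beadRegion j 2 := by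
    change (0, 3) ∈ beadPoints 2
    decide
  have m6 : ((0, 3) : ℤ × ℤ) ∈ beadRegion j 6 := ⟨rfl, le_rfl, by simp⟩
  by_cases hx : x = 6
  · subst hx
    obtain rfl : y = 2 := by revert h; revert y; decide
    exact ⟨(0, 3), m6, m2, Or.inl (isEnd_beadPath_six (Or.inl rfl)), h62⟩
  by_cases hy : y = 6
  · subst hy
    obtain rfl : x = 2 := by clear hx; revert h; revert x; decide
    exact ⟨(0, 3), m2, m6, Or.inr (isEnd_beadPath_six (Or.inl rfl)), fun q h h' => h62 q h' h⟩
  have key : ∀ x y : Fin 7, x ≠ 6 → y ≠ 6 → BeadAdj x y → ∃ p ∈ beadPoints x, p ∈ beadPoints y ∧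
      ((p = (beadPoints x).getD 0 0 ∨ p = (beadPoints x).getD ((beadPoints x).length - 1) 0) ∨
        (p = (beadPoints y).getD 0 0 ∨ p = (beadPoints y).getD ((beadPoints y).length - 1) 0)) ∧
      ∀ q ∈ beadPoints x, q ∈ beadPoints y → q = p := by decide
  obtain ⟨p, h1, h2, h3, h4⟩ := key x y hx hy h
  simp only [beadRegion, if_neg hx, if_neg hy]
  exact ⟨p, h1, h2, h3.imp (isEnd_beadPath hx) (isEnd_beadPath hy), h4⟩

theorem disjoint_beadPath {j : ℕ} {x y : Fin 7} (hxy : x ≠ y) (h : ¬ BeadAdj x y) :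
    Disjoint (beadPath j x).points (beadPath j y).points := by
  suffices key : ∀ q, q ∈ beadRegion j x → q ∉ beadRegion j y by
    rw [Set.disjoint_left]
    intro z hz hz'
    obtain ⟨q, hq, rfl⟩ := mem_points_beadPath.1 hz
    obtain ⟨r, hr, hqr⟩ := mem_points_beadPath.1 hz'
    obtain rfl := place_injective j hqr
    exact key r hq hr
  have h6 : ∀ x : Fin 7, ∀ p ∈ beadPoints x, p.1 = 0 → 3 ≤ p.2 → x = 2 := by decide
  by_cases hx : x = 6
  · subst hx
    intro q hq hq'
    rw [beadRegion, if_neg (Ne.symm hxy)] at hq'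
    obtain rfl := h6 y q hq' hq.1 hq.2.1
    exact h (by decide)
  by_cases hy : y = 6
  · subst hy
    intro q hq hq'
    rw [beadRegion, if_neg hx] at hq
    obtain rfl := h6 x q hq hq'.1 hq'.2.1
    exact h (by decide)
  have key : ∀ x y : Fin 7, x ≠ y → ¬ BeadAdj x y → ∀ p ∈ beadPoints x, p ∉ beadPoints y := by
    decide
  simp only [beadRegion, if_neg hx, if_neg hy]
  exact key x y hxy h

theorem meetAtEnd_beadPath_pole {m : ℕ} (hm : 1 < m) {i : Fin m} {x : Fin 7} {p : Bool}
    (h : PoleAdj p x) : (beadPath i x).MeetAtEnd (necklacePath hm (.inr p)) := by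
  cases p
  · have hx : x ≠ 6 := by clear hm; revert h; revert x; decide
    have key : ∀ x : Fin 7, PoleAdj false x → ∃ p ∈ beadPoints x,
        (p = (beadPoints x).getD 0 0 ∨ p = (beadPoints x).getD ((beadPoints x).length - 1) 0) ∧
        (-3 ≤ p.1 ∧ p.1 ≤ 0 ∧ p.2 = 0) ∧ ∀ q ∈ beadPoints x, q.2 = 0 → q.1 ≤ 0 → q = p := by decide
    obtain ⟨⟨a, b⟩, h1, h2, ⟨h3, h4, h5⟩, h6⟩ := key x h
    simp only at h3 h4 h5
    subst h5
    refine ⟨place i (a, 0), mem_points_beadPath.2 ⟨_, ?_, rfl⟩, ?_, Or.inl (isEnd_beadPath hx h2), ?_⟩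
    · rwa [beadRegion, if_neg hx]
    · exact (mem_points_necklacePath_false hm).2 (exists_stairs_eq_place i.2 hm h3 h4)
    · intro z hz hz'
      obtain ⟨q, hq, rfl⟩ := mem_points_beadPath.1 hz
      obtain ⟨n, -, hn⟩ := (mem_points_necklacePath_false hm).1 hz'
      obtain ⟨h7, h8⟩ := stairs_eq_place hq hn
      rw [beadRegion, if_neg hx] at hq
      rw [h6 q hq h7 h8]
  · obtain rfl : x = 6 := h
    refine ⟨place i (0, 3 + (stringLength i : ℤ)), mem_points_beadPath.2 ⟨_, ?_, rfl⟩, ?_,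
      Or.inl (isEnd_beadPath_six (Or.inr rfl)), ?_⟩
    · exact ⟨rfl, by simp, le_rfl⟩
    · exact (mem_points_necklacePath_true hm).2 (exists_frame_eq_place i.2)
    · intro z hz hz'
      obtain ⟨q, hq, rfl⟩ := mem_points_beadPath.1 hz
      obtain ⟨n, -, hn⟩ := (mem_points_necklacePath_true hm).1 hz'
      rw [frame_eq_place hq hn]

theorem disjoint_beadPath_pole {m : ℕ} (hm : 1 < m) {i : Fin m} {x : Fin 7} {p : Bool}
    (h : ¬ PoleAdj p x) :
    Disjoint (beadPath i x).points (necklacePath hm (.inr p)).points := by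
  rw [Set.disjoint_left]
  intro z hz hz'
  obtain ⟨q, hq, rfl⟩ := mem_points_beadPath.1 hz
  cases p
  · obtain ⟨n, -, hn⟩ := (mem_points_necklacePath_false hm).1 hz'
    obtain ⟨h1, h2⟩ := stairs_eq_place hq hn
    by_cases hx : x = 6
    · subst hx
      have := hq.2.1
      omega
    · have key : ∀ x : Fin 7, ¬ PoleAdj false x → ∀ q ∈ beadPoints x, q.2 ≠ 0 := by decide
      rw [beadRegion, if_neg hx] at hq
      exact key x h q hq h1
  · obtain ⟨n, -, hn⟩ := (mem_points_necklacePath_true hm).1 hz'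
    have hx : x ≠ 6 := h
    have := frame_eq_place hq hn
    subst this
    rw [beadRegion, if_neg hx] at hq
    have key : ∀ x : Fin 7, ∀ q ∈ beadPoints x, q.2 ≤ 3 := by decide
    have := key x _ hq
    simp only [stringLength] at this
    split_ifs at this <;> omega

theorem isBendCPG_necklace {m k : ℕ} (hm : m ≤ k + 2) (hm1 : 1 < m) (hk : 2 ≤ k) :
    IsBendCPG k (necklace m) := by
  have poles : Disjoint (necklacePath hm1 (.inr false)).points
      (necklacePath hm1 (.inr true)).points := by
    rw [Set.disjoint_left]
    intro z hz hz'
    obtain ⟨n, -, rfl⟩ := (mem_points_necklacePath_false hm1).1 hz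
    obtain ⟨n', -, hn⟩ := (mem_points_necklacePath_true hm1).1 hz'
    exact stairs_ne_frame m n n' hn.symm
  have bead_pole : ∀ i x p,
      ((necklace m).Adj (.inl (i, x)) (.inr p) ∧
        (necklacePath hm1 (.inl (i, x))).MeetAtEnd (necklacePath hm1 (.inr p))) ∨
      (¬ (necklace m).Adj (.inl (i, x)) (.inr p) ∧
        Disjoint (necklacePath hm1 (.inl (i, x))).points (necklacePath hm1 (.inr p)).points) := by
    intro i x p
    by_cases h : PoleAdj p x
    · exact Or.inl ⟨h, meetAtEnd_beadPath_pole hm1 h⟩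
    · exact Or.inr ⟨h, disjoint_beadPath_pole hm1 h⟩
  refine ⟨.ofMeetAtEnd (necklacePath hm1) ?_, ?_⟩
  · rintro (⟨i, x⟩ | p) (⟨j, y⟩ | q) huv
    · by_cases hij : i = j
      · subst hij
        have hxy : x ≠ y := fun h => huv (h ▸ rfl)
        by_cases h : BeadAdj x y
        · exact Or.inl ⟨⟨rfl, h⟩, meetAtEnd_beadPath h⟩
        · exact Or.inr ⟨fun h' => h h'.2, disjoint_beadPath hxy h⟩
      · refine Or.inr ⟨fun h => hij h.1, Set.disjoint_left.2 fun z hz hz' => ?_⟩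
        obtain ⟨p, hp, rfl⟩ := mem_points_beadPath.1 hz
        obtain ⟨q, hq, hpq⟩ := mem_points_beadPath.1 hz'
        exact place_ne_place (fun h => hij (Fin.ext h.symm)) hq hp hpq
    · exact bead_pole i x q
    · exact (bead_pole j y p).imp (fun h => ⟨h.1, h.2.symm⟩) fun h => ⟨h.1, h.2.symm⟩
    · refine Or.inr ⟨fun h => h, ?_⟩
      cases p <;> cases q
      · exact absurd rfl huv
      · exact poles
      · exact poles.symm
      · exact absurd rfl huv
  · rintro (⟨i, x⟩ | _ | _) <;> change (necklacePath hm1 _).bends ≤ k <;> unfold necklacePath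
    · exact (bends_beadPath_le i x).trans hk
    -- The stairs turn only at the multiples of 8 strictly between `0` and `8 * (m - 1)`.
    · refine (GridPath.bends_ofFun_le (s := (Finset.Ioo 0 (m - 1)).image (8 * ·))
        fun n h0 h1 h => ?_).trans
        (Finset.card_image_le.trans (by rw [Nat.card_Ioo]; omega))
      by_contra hn
      refine h ?_
      have h8 : n % 8 ≠ 0 := fun h8 => hn (Finset.mem_image.2
        ⟨n / 8, Finset.mem_Ioo.2 ⟨by omega, by omega⟩, by omega⟩)
      obtain ⟨n, rfl⟩ : ∃ n', n = n' + 1 := ⟨n - 1, by omega⟩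
      simp only [stairs, Prod.mk_sub_mk, Prod.mk.injEq, Nat.add_sub_cancel]
      omega
    -- The frame turns once, at its corner `(-11, 5)`.
    · refine (GridPath.bends_ofFun_le (s := {8 * m + 11})
        fun n h0 h1 h => ?_).trans (by rw [Finset.card_singleton]; omega)
      by_contra hn
      refine h ?_
      rw [Finset.mem_singleton] at hn
      obtain ⟨n, rfl⟩ : ∃ n', n = n' + 1 := ⟨n - 1, by omega⟩
      simp only [frame, Prod.mk_sub_mk, Prod.mk.injEq, Nat.add_sub_cancel]
      omega


/-! ### Strictness of the hierarchy -/

theorem exists_finiteGraph {V : Type*} [Fintype V] {G : SimpleGraph V} {k : ℕ} (hp : IsPlanar G)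
    (h : IsBendCPG (k + 1) G) (h' : ¬ IsBendCPG k G) :
    ∃ H : FiniteGraph, IsPlanar H.2 ∧ IsBendCPG (k + 1) H.2 ∧ ¬ IsBendCPG k H.2 := by
  let e := Fintype.equivFin V
  refine ⟨⟨_, G.comap e.symm.toEmbedding⟩, hp.comap _, h.comap _, fun hk => h' ?_⟩
  have := hk.comap e.toEmbedding
  rw [SimpleGraph.comap_comap] at this
  convert this
  ext u v
  simp

/-- The necklace with `k + 3` beads works once `k + 1` is at least 2, the number of bends allowed
inside a bead; the book covers `k = 0`. -/
theorem exists_planar_bendCPG (k : ℕ) :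
    ∃ H : FiniteGraph, IsPlanar H.2 ∧ IsBendCPG (k + 1) H.2 ∧ ¬ IsBendCPG k H.2 := by
  rcases Nat.eq_zero_or_pos k with rfl | hk
  · exact exists_finiteGraph (isPlanar_book (by omega)) (isBendCPG_one_book 9)
      not_isBendCPG_zero_book
  · refine exists_finiteGraph (isPlanar_necklace (m := k + 3) (by omega))
      (isBendCPG_necklace (by omega) (by omega) (by omega)) ?_
    rintro ⟨R, hR⟩
    have := necklace_le_bends R
    have := hR (.inr false)
    omega

end CPG

theorem mainTheorem1 :
    (∀ k : ℕ, ∃ G : CPG.FiniteGraph,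
      CPG.IsPlanar G.2 ∧ CPG.IsBendCPG (k + 1) G.2 ∧ ¬ CPG.IsBendCPG k G.2 ∧
        ∀ R : CPG.Representation G.2, ∃ v : Fin G.1, k + 1 ≤ (R.path v).bends) ∧
    (∀ k : ℕ,
      CPG.bendCPGGraphs k ⊂ CPG.bendCPGGraphs (k + 1) ∧
        CPG.planarGraphs ∩ CPG.bendCPGGraphs k ⊂
          CPG.planarGraphs ∩ CPG.bendCPGGraphs (k + 1)) ∧
    CPG.bendNumber (CPG.planarGraphs ∩ CPG.cpgGraphs) = ⊤ := by
  have mono : ∀ k, CPG.bendCPGGraphs k ⊆ CPG.bendCPGGraphs (k + 1) := fun k _ hG =>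
    CPG.IsBendCPG.mono k.le_succ hG
  refine ⟨fun k => ?_, fun k => ?_, ?_⟩
  · obtain ⟨G, h1, h2, h3⟩ := CPG.exists_planar_bendCPG k
    refine ⟨G, h1, h2, h3, fun R => ?_⟩
    by_contra! h
    exact h3 ⟨R, fun v => Nat.lt_succ_iff.1 (h v)⟩
  · obtain ⟨G, h1, h2, h3⟩ := CPG.exists_planar_bendCPG k
    exact ⟨⟨mono k, fun h => h3 (h h2)⟩,
      ⟨Set.inter_subset_inter_right _ (mono k), fun h => h3 (h ⟨h1, h2⟩).2⟩⟩
  · rw [CPG.bendNumber, sInf_eq_top]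
    rintro _ ⟨k, -, hk⟩
    obtain ⟨G, h1, ⟨R, -⟩, h3⟩ := CPG.exists_planar_bendCPG k
    exact absurd (hk ⟨h1, ⟨R⟩⟩) h3
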